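/- Let $\gamma\in(0,1)$, $M>0$ and let $\kappa\ge\kappa(M,\gamma):=\sqrt{\big(48M^2(2+2/\sqrt\gamma+1/\gamma)+12M^2\big)/\gamma}$. Consider a stochastic bandit with two arms, in which the rewards $r_t(a)$ of arm $a$ are independent over the rounds $t$ with a common law of mean $\mu_a$, and $|r_t(a)|\le M$ almost surely. Doubly adaptive Thompson sampling (DATS) with horizon $T$, exploration level $\gamma$ and scale $\kappa$ is the following algorithm. Each arm is pulled once initially; $\bar r_{t,a}$ denotes the average of all rewards of arm $a$ observed in the initial pull and in rounds $1,\dots,t$; and $\mathcal A_1=\{1,2\}$, $\pi_{1,a}=1/2$. In each round $t=1,\dots,T$, conditionally on the past, arm $a_t=a$ is pulled with probability $\pi_{t,a}$ (which is $0$ for $a\notin\mathcal A_t$), and $r_t=r_t(a_t)$ is observed. Then, with $$\hat\Gamma_{s,a}=\bar r_{s-1,a}+\mathbf 1\{a_s=a\}\frac{r_s-\bar r_{s-1,a}}{\pi_{s,a}},\qquad \hat\mu_{t,a}=\frac{\sum_{s=1}^t\sqrt{\pi_{s,a}}\,\hat\Gamma_{s,a}}{\sum_{s=1}^t\sqrt{\pi_{s,a}}},\qquad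 \hat\sigma^2_{t,a}=\frac{\sum_{s=1}^t\pi_{s,a}\big[(\hat\Gamma_{s,a}-\hat\mu_{t,a})^2+1\big]}{\big(\sum_{s=1}^t\sqrt{\pi_{s,a}}\big)^2},$$ the set $\mathcal A_{t+1}$ is obtained from $\mathcal A_t$ by removing every $a\in\mathcal A_t$ with $\min_{a'\in\mathcal A_t}\Phi\Big(\frac{\hat\mu_{t,a}-\hat\mu_{t,a'}}{\kappa\sqrt{\hat\sigma^2_{t,a}+\hat\sigma^2_{t,a'}}}\Big)<1/T$, where $\Phi$ is the standard normal distribution function; and for $a\in\mathcal A_{t+1}$, $\pi_{t+1,a}=(1-\gamma)q_{t+1,a}+\gamma/|\mathcal A_{t+1}|$, where $q_{t+1,a}$ is the probability that $\tilde r_a$ is the largest of independent samples $\tilde r_{a'}\sim\mathcal N(\hat\mu_{t,a'},\kappa^2\hat\sigma^2_{t,a'})$, $a'\in\mathcal A_{t+1}$. Then there is a constant $C$, depending only on $M$, $\gamma$ and $\kappa$, such that for every $T\ge1$ and every such two-arm bandit, the realized regret $\mathrm{Regret}(T,\pi)=\sum_{t=1}^T\big(\max_a\mu_a-\mu_{a_t}\big)$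 satisfies $$\mathbb P\Big(\mathrm{Regret}(T,\pi)\le C\sqrt{T\log T}\Big)\ \ge\ 1-\frac{2}{T^2}-\frac{2\log T}{T^2}.$$ -/

import Mathlib

open MeasureTheory ProbabilityTheory

namespace DATS

noncomputable section

/-- What one run of a bandit algorithm with `K` arms produces: the reward of the initial pull of
every arm, then, for the rounds `s = 0, 1, 2, …`, the arm pulled and the reward observed.
(Rounds are counted from `0`: the `t`-th round in the usual counting from `1` is round `t - 1`.) -/
structure Path (K : ℕ) where
  init : Fin K → ℝ
  arm : ℕ → Fin K
  reward : ℕ → ℝ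

variable {K : ℕ}

/-- Number of observations of arm `b` after `t` rounds, including the initial pull. -/
def Path.count (h : Path K) (t : ℕ) (b : Fin K) : ℕ :=
  1 + ((Finset.range t).filter fun s => h.arm s = b).card

/-- Sample average of the rewards of arm `b` after `t` rounds, including the initial pull. -/
def Path.avg (h : Path K) (t : ℕ) (b : Fin K) : ℝ :=
  (h.init b + ∑ s ∈ Finset.range t, if h.arm s = b then h.reward s else 0) / (h.count t b : ℝ)

/-- Doubly robust score of arm `b` in round `s`, where `p s b` is the propensity of arm `b` in
round `s`. -/
def Path.score (h : Path K) (p : ℕ → Fin K → ℝ) (s : ℕ) (b : Fin K) : ℝ :=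
  h.avg s b + if h.arm s = b then (h.reward s - h.avg s b) / p s b else 0

/-- Adaptively weighted doubly robust estimate of the mean of arm `b` after `t` rounds. -/
def Path.muHat (h : Path K) (p : ℕ → Fin K → ℝ) (t : ℕ) (b : Fin K) : ℝ :=
  (∑ s ∈ Finset.range t, √(p s b) * h.score p s b) / ∑ s ∈ Finset.range t, √(p s b)

/-- Estimated variance of `muHat`, with the auxiliary `+ 1`. -/
def Path.varHat (h : Path K) (p : ℕ → Fin K → ℝ) (t : ℕ) (b : Fin K) : ℝ :=
  (∑ s ∈ Finset.range t, p s b * ((h.score p s b - h.muHat p t b) ^ 2 + 1)) /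
    (∑ s ∈ Finset.range t, √(p s b)) ^ 2

open Classical in
/-- Arm elimination. The sampling distribution of arm `b` is `N(m b, κ² * v b)`. Arm `b ∈ A` is
removed when `min_{b' ∈ A} Φ((m b - m b') / (κ * √(v b + v b')))` is less than `1 / T`, that is,
when one of these numbers is. -/
def survivors (T : ℕ) (κ : ℝ) (A : Finset (Fin K)) (m v : Fin K → ℝ) : Finset (Fin K) :=
  A.filter fun b => ∀ b' ∈ A,
    1 / (T : ℝ) ≤ cdf (gaussianReal 0 1) ((m b - m b') / (κ * √(v b + v b')))

/-- Probability that arm `b` has the largest sample among the arms of `A`, for independent samples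
`y b' ∼ N(m b', κ² * v b')`. -/
def thompson (κ : ℝ) (A : Finset (Fin K)) (m v : Fin K → ℝ) (b : Fin K) : ℝ :=
  (Measure.pi fun b' => gaussianReal (m b') (κ ^ 2 * v b').toNNReal).real
    {y | ∀ b' ∈ A, b' ≠ b → y b' < y b}

/-- Propensities: Thompson sampling on the eligible arms `A`, mixed with uniform exploration of
`A` at level `γ`; arms outside `A` are not pulled. -/
def propensity (γ κ : ℝ) (A : Finset (Fin K)) (m v : Fin K → ℝ) (b : Fin K) : ℝ :=
  if b ∈ A then (1 - γ) * thompson κ A m v b + γ / (A.card : ℝ) else 0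

/-- State of the algorithm before round `t`: the set of eligible arms in round `t`, and the table
of the propensities of the rounds `0, …, t` (its later entries are never used). -/
def Path.state (h : Path K) (T : ℕ) (γ κ : ℝ) : ℕ → Finset (Fin K) × (ℕ → Fin K → ℝ)
  | 0 => (Finset.univ, fun _ _ => 1 / (K : ℝ))
  | t + 1 =>
    let A := (h.state T γ κ t).1
    let p := (h.state T γ κ t).2
    let m := h.muHat p (t + 1)
    let v := h.varHat p (t + 1)
    let A' := survivors T κ A m v
    (A', Function.update p (t + 1) (propensity γ κ A' m v))

/-- Eligible arms of doubly adaptive Thompson sampling in round `t`. -/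
def Path.active (h : Path K) (T : ℕ) (γ κ : ℝ) (t : ℕ) : Finset (Fin K) :=
  (h.state T γ κ t).1

/-- Propensity of arm `b` in round `t` of doubly adaptive Thompson sampling. -/
def Path.prop (h : Path K) (T : ℕ) (γ κ : ℝ) (t : ℕ) (b : Fin K) : ℝ :=
  (h.state T γ κ t).2 t b

theorem Path.state_snd (h : Path K) (T : ℕ) (γ κ : ℝ) {s t : ℕ} (hst : s ≤ t) :
    (h.state T γ κ t).2 s = h.prop T γ κ s := by
  induction t, hst using Nat.le_induction with
  | base => rfl
  | succ t hst ih =>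
    rw [← ih]
    simp only [Path.state]
    exact Function.update_of_ne (by omega) _ _

theorem Path.score_congr (h : Path K) {p p' : ℕ → Fin K → ℝ} {s : ℕ} (e : p s = p' s) :
    h.score p s = h.score p' s := by
  funext b; simp only [Path.score, e]

theorem Path.muHat_congr (h : Path K) {p p' : ℕ → Fin K → ℝ} {t : ℕ}
    (e : ∀ s < t, p s = p' s) : h.muHat p t = h.muHat p' t := by
  funext b
  unfold Path.muHat
  congr 1
  · exact Finset.sum_congr rfl fun s hs => by
      rw [e s (Finset.mem_range.1 hs), h.score_congr (e s (Finset.mem_range.1 hs))]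
  · exact Finset.sum_congr rfl fun s hs => by rw [e s (Finset.mem_range.1 hs)]

theorem Path.varHat_congr (h : Path K) {p p' : ℕ → Fin K → ℝ} {t : ℕ}
    (e : ∀ s < t, p s = p' s) : h.varHat p t = h.varHat p' t := by
  funext b
  unfold Path.varHat
  congr 1
  · exact Finset.sum_congr rfl fun s hs => by
      rw [e s (Finset.mem_range.1 hs), h.score_congr (e s (Finset.mem_range.1 hs)),
        h.muHat_congr e]
  · exact congrArg (· ^ 2)
      (Finset.sum_congr rfl fun s hs => by rw [e s (Finset.mem_range.1 hs)])

theorem Path.active_zero (h : Path K) (T : ℕ) (γ κ : ℝ) :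
    h.active T γ κ 0 = Finset.univ := rfl

theorem Path.prop_zero (h : Path K) (T : ℕ) (γ κ : ℝ) (b : Fin K) :
    h.prop T γ κ 0 b = 1 / (K : ℝ) := rfl

/-- The elimination step, written with the propensities themselves. -/
theorem Path.active_succ (h : Path K) (T : ℕ) (γ κ : ℝ) (t : ℕ) :
    h.active T γ κ (t + 1) =
      survivors T κ (h.active T γ κ t) (h.muHat (h.prop T γ κ) (t + 1))
        (h.varHat (h.prop T γ κ) (t + 1)) := by
  have e : ∀ s < t + 1, (h.state T γ κ t).2 s = h.prop T γ κ s :=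
    fun s hs => h.state_snd T γ κ (by omega)
  rw [← h.muHat_congr e, ← h.varHat_congr e]
  rfl

/-- The propensity step, written with the propensities themselves. -/
theorem Path.prop_succ (h : Path K) (T : ℕ) (γ κ : ℝ) (t : ℕ) :
    h.prop T γ κ (t + 1) =
      propensity γ κ (h.active T γ κ (t + 1)) (h.muHat (h.prop T γ κ) (t + 1))
        (h.varHat (h.prop T γ κ) (t + 1)) := by
  have e : ∀ s < t + 1, (h.state T γ κ t).2 s = h.prop T γ κ s :=
    fun s hs => h.state_snd T γ κ (by omega)
  rw [← h.muHat_congr e, ← h.varHat_congr e]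
  funext b
  simp only [Path.prop, Path.active, Path.state, Function.update_self]

/-- The two-arm scale `κ(M, γ)` of the sampling standard deviations. -/
def kappa (M γ : ℝ) : ℝ :=
  √((48 * M ^ 2 * (2 + 2 / √γ + 1 / γ) + 12 * M ^ 2) / γ)

variable {Ω : Type*}

/-- The path observed at the sample point `ω`: in round `s` only the reward
`r s (a s ω) ω` of the arm pulled is observed. -/
def pathOf (init : Fin K → Ω → ℝ) (r : ℕ → Fin K → Ω → ℝ) (a : ℕ → Ω → Fin K) (ω : Ω) : Path K :=
  ⟨fun b => init b ω, fun s => a s ω, fun s => r s (a s ω) ω⟩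

/-- The `σ`-algebra of the observations made before round `t`: the initial rewards, and the arms
pulled and rewards observed in the rounds `0, …, t - 1`. -/
@[reducible]
def history (init : Fin K → Ω → ℝ) (r : ℕ → Fin K → Ω → ℝ) (a : ℕ → Ω → Fin K) (t : ℕ) :
    MeasurableSpace Ω :=
  (⨆ b, MeasurableSpace.comap (init b) inferInstance) ⊔
    ⨆ s ∈ Finset.range t, (MeasurableSpace.comap (a s) ⊤ ⊔
      MeasurableSpace.comap (fun ω => r s (a s ω) ω) inferInstance)

/-- A run over `T` rounds of doubly adaptive Thompson sampling (exploration level `γ`, scale `κ`)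
on the stochastic bandit whose arm `b` has reward law `ν b`, on the probability space `(Ω, P)`.
`init b` is the reward of the initial pull of arm `b`, `r t b` the reward that arm `b` would give
in round `t`, and `a t` the arm pulled in round `t`. -/
structure IsRun [MeasurableSpace Ω] (P : Measure Ω) (ν : Fin K → Measure ℝ) (T : ℕ) (γ κ : ℝ)
    (init : Fin K → Ω → ℝ) (r : ℕ → Fin K → Ω → ℝ) (a : ℕ → Ω → Fin K) : Prop where
  measurable_init : ∀ b, Measurable (init b)
  measurable_reward : ∀ t b, Measurable (r t b)
  measurable_arm : ∀ t, Measurable (a t)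
  law_init : ∀ b, P.map (init b) = ν b
  law_reward : ∀ t < T, ∀ b, P.map (r t b) = ν b
  /-- The rewards of round `t` are independent of the past and of the arm chosen in round `t`. -/
  indep : ∀ t < T, Indep (MeasurableSpace.comap (fun ω b => r t b ω) inferInstance)
    (history init r a t ⊔ MeasurableSpace.comap (a t) ⊤) P
  /-- Given the past, arm `b` is pulled with the probability that the algorithm prescribes. -/
  arm_law : ∀ t < T, ∀ b,
    P⟦a t ⁻¹' {b} | history init r a t⟧ =ᵐ[P] fun ω => (pathOf init r a ω).prop T γ κ t b

/-- Realized regret over the rounds `0, …, T - 1`: the sum of the gaps between the best mean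
reward and the mean reward of the arm pulled. -/
def regret (ν : Fin K → Measure ℝ) (a : ℕ → Ω → Fin K) (T : ℕ) (ω : Ω) : ℝ :=
  ∑ t ∈ Finset.range T, ((⨆ b, ∫ x, x ∂ν b) - ∫ x, x ∂ν (a t ω))

end

end DATS

/-! The weighted deviations `√p * (score - μ)` of an arm form a martingale difference sequence:
given the past, the arm is pulled with probability `p`, so the inverse propensity correction removes
the bias of the plug-in average. While both arms are eligible, `p ≥ γ / 2`, and each difference lies
in a predictable interval of length at most `2 * M / √(γ / 2)`. Azuma–Hoeffding
(`measureReal_abs_sum_ge_le`) then bounds the deviation sums by `M * √(12 * t * log T / γ)`, each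
time and arm failing with probability at most `2 / T ^ 3`. A union bound over fewer than `2 * T`
pairs costs at most `4 / T ^ 2`.

The rest is deterministic on the good event. The `+ 1` in `varHat` keeps its numerator at least `t *
γ / 2`, so the choice of `κ` turns the deviation bound into an error of at most `√(log T) * κ *
√(varHat / 2)` (`Path.estimates`). The estimated gap is therefore off by at most `√(log T)` sampling
standard deviations. Since `Φ(-√(log T)) ≥ 1 / T` for `T ≥ exp 16`, the best arm is never removed.
Since `Φ(-x) ≤ exp (-x ^ 2 / 2)`, a surviving inferior arm has estimated gap at most `√(2 * log T)`
standard deviations, hence true gap `O(√(log T / t))`, because `varHat = O(1 / t)`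
(`Path.best_mem_active`).

Summing `1 / √t` gives regret `O(√(T * log T))`. Horizons below `exp 16` are absorbed in the
constant. -/

namespace DATS

/-! ### Gaussian tails. -/

section

/-- Tail bound for the standard normal distribution function. -/
theorem cdf_gaussian_le {x : ℝ} (hx : x ≤ 0) :
    cdf (gaussianReal 0 1) x ≤ Real.exp (-x ^ 2 / 2) := by
  rw [cdf_eq_real]
  have h := measure_le_le_exp_mul_mgf (μ := gaussianReal 0 1) (X := id) (t := x) x hx
    (integrable_exp_mul_gaussianReal x)
  rw [mgf_id_gaussianReal, ← Real.exp_add] at h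
  refine h.trans (le_of_eq ?_)
  congr 1
  simp
  ring

theorem neg_sqrt_two_log_le_of_le_cdf {T x : ℝ} (hT : 0 < T)
    (h : 1 / T ≤ cdf (gaussianReal 0 1) x) : -√(2 * Real.log T) ≤ x := by
  by_contra! hx
  have h0 : x < 0 := hx.trans_le (by simp)
  have h1 := h.trans (cdf_gaussian_le h0.le)
  rw [one_div, ← Real.exp_log hT, ← Real.exp_neg, Real.exp_le_exp] at h1
  have h2 : √(2 * Real.log T) < -x := by linarith
  rw [Real.sqrt_lt' (by linarith)] at h2
  nlinarith

/-- Integrate the density over the unit interval left of `-x`: there it is at least `exp (-1) * exp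
(-(x + 1) ^ 2 / 2)`, and `(x + 1) ^ 2 / 2 ≤ x ^ 2 - 1` once `x ≥ 3`. -/
theorem exp_neg_sq_le_cdf_gaussian {x : ℝ} (hx : 4 ≤ x) :
    Real.exp (-x ^ 2) ≤ cdf (gaussianReal 0 1) (-x) := by
  rw [cdf_eq_real]
  have hsub : Set.Icc (-x - 1) (-x) ⊆ Set.Iic (-x) := fun y hy => hy.2
  refine le_trans ?_ (measureReal_mono hsub)
  rw [measureReal_def, gaussianReal_apply_eq_integral _ one_ne_zero,
    ENNReal.toReal_ofReal (integral_nonneg (gaussianPDFReal_nonneg _ _))]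
  have hc : ∀ y ∈ Set.Icc (-x - 1) (-x), Real.exp (-x ^ 2) ≤ gaussianPDFReal 0 1 y := by
    intro y hy
    rw [gaussianPDFReal]
    have h1 : √(2 * Real.pi * ((1 : NNReal) : ℝ)) ≤ Real.exp 1 := by
      rw [Real.sqrt_le_left (Real.exp_pos 1).le]
      have := Real.exp_one_gt_d9
      have := Real.pi_lt_d2
      push_cast
      nlinarith
    have h0 : 0 < √(2 * Real.pi * ((1 : NNReal) : ℝ)) := by
      rw [Real.sqrt_pos]; have := Real.pi_pos; push_cast; linarith
    have h2 : Real.exp (-1) ≤ (√(2 * Real.pi * ((1 : NNReal) : ℝ)))⁻¹ := by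
      rw [Real.exp_neg]; exact inv_anti₀ h0 h1
    have h3 : Real.exp (-x ^ 2 + 1) ≤ Real.exp (-(y - 0) ^ 2 / (2 * ((1 : NNReal) : ℝ))) := by
      rw [Real.exp_le_exp]
      push_cast
      have := hy.1
      have := hy.2
      nlinarith
    calc Real.exp (-x ^ 2) = Real.exp (-1) * Real.exp (-x ^ 2 + 1) := by
          rw [← Real.exp_add]; ring_nf
      _ ≤ _ := mul_le_mul h2 h3 (Real.exp_pos _).le (inv_nonneg.2 h0.le)
  have h := setIntegral_mono_on (μ := volume) (s := Set.Icc (-x - 1) (-x))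
    (integrableOn_const (by simp) (by simp)) (integrable_gaussianPDFReal 0 1).integrableOn
    measurableSet_Icc hc
  simpa using h

theorem one_div_le_cdf_neg_sqrt_log {T : ℝ} (hT : Real.exp 16 ≤ T) :
    1 / T ≤ cdf (gaussianReal 0 1) (-√(Real.log T)) := by
  have hT0 : 0 < T := (Real.exp_pos _).trans_le hT
  have hl : 16 ≤ Real.log T := by rwa [Real.le_log_iff_exp_le hT0]
  have h := exp_neg_sq_le_cdf_gaussian (x := √(Real.log T))
    (Real.le_sqrt_of_sq_le (by norm_num; exact hl))
  rwa [Real.sq_sqrt (by linarith), Real.exp_neg, Real.exp_log hT0, ← one_div] at h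

/-! ### Exponential martingale bounds with predictable intervals. -/

/-- The left side, the height at `0` of the chord of `exp`, is the moment generating function at `1`
of the centred law on `{lo, hi}`, so Hoeffding's lemma for that law gives the bound. -/
theorem chord_zero_le {lo hi : ℝ} (hlo : lo ≤ 0) (hhi : 0 ≤ hi) (hlt : lo < hi) :
    hi / (hi - lo) * Real.exp lo + -lo / (hi - lo) * Real.exp hi
      ≤ Real.exp ((hi - lo) ^ 2 / 8) := by
  have hd : 0 < hi - lo := by linarith
  have hp : 0 ≤ hi / (hi - lo) := by positivity
  have hq : 0 ≤ -lo / (hi - lo) := div_nonneg (by linarith) hd.le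
  have hpq : hi / (hi - lo) + -lo / (hi - lo) = 1 := by field_simp; ring
  set p := hi / (hi - lo) with hpdef
  set q := -lo / (hi - lo) with hqdef
  set m : Measure ℝ := ENNReal.ofReal p • Measure.dirac lo + ENNReal.ofReal q • Measure.dirac hi
    with hm
  have : IsProbabilityMeasure m := ⟨by
    simp [hm]
    rw [← ENNReal.ofReal_add hp hq, hpq, ENNReal.ofReal_one]⟩
  have hint : ∀ f : ℝ → ℝ, ∫ x, f x ∂m = p * f lo + q * f hi := by
    intro f
    rw [hm, integral_add_measure, integral_smul_measure, integral_smul_measure,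
      integral_dirac, integral_dirac, ENNReal.toReal_ofReal hp, ENNReal.toReal_ofReal hq]
    · rfl
    · exact (integrable_dirac (by simp)).smul_measure (by simp)
    · exact (integrable_dirac (by simp)).smul_measure (by simp)
  have hmem : ∀ᵐ x ∂m, id x ∈ Set.Icc lo hi := by
    rw [hm, ae_add_measure_iff]
    constructor
    · exact Measure.ae_smul_measure (by rw [ae_dirac_eq]; simp [hlt.le]) _
    · exact Measure.ae_smul_measure (by rw [ae_dirac_eq]; simp [hlt.le]) _
  have h0 : ∫ x, id x ∂m = 0 := by
    rw [hint, hpdef, hqdef]; simp; field_simp; ring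
  have h := (hasSubgaussianMGF_of_mem_Icc_of_integral_eq_zero aemeasurable_id hmem h0).mgf_le 1
  rw [mgf, hint] at h
  simp only [one_mul, id] at h
  refine h.trans (le_of_eq ?_)
  congr 1
  simp [abs_of_pos hd]
  ring

/-- Slope of the chord of the exponential function over `[lo, hi]`. -/
noncomputable def chordSlope (lo hi : ℝ) : ℝ := (Real.exp hi - Real.exp lo) / (hi - lo)

/-- A pointwise form of Hoeffding's lemma, from convexity. The term linear in `y` disappears under a
conditional expectation, so no conditional distributions are needed when the interval is random. -/
theorem exp_le_add_chordSlope_mul {lo hi y R : ℝ} (hlo : lo ≤ 0) (hhi : 0 ≤ hi)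
    (hR : hi - lo ≤ R) (h1 : lo ≤ y) (h2 : y ≤ hi) :
    Real.exp y ≤ Real.exp (R ^ 2 / 8) + chordSlope lo hi * y := by
  rcases (hlo.trans hhi).eq_or_lt with h | hlt
  · have hy : y = 0 := by linarith
    subst hy
    simp only [mul_zero, add_zero, Real.exp_le_exp]
    positivity
  have hd : 0 < hi - lo := by linarith
  have hc := convexOn_exp.2 (Set.mem_univ lo) (Set.mem_univ hi)
    (show 0 ≤ (hi - y) / (hi - lo) from div_nonneg (by linarith) hd.le)
    (show 0 ≤ (y - lo) / (hi - lo) from div_nonneg (by linarith) hd.le) (by field_simp; ring)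
  simp only [smul_eq_mul] at hc
  have e1 : (hi - y) / (hi - lo) * lo + (y - lo) / (hi - lo) * hi = y := by field_simp; ring
  rw [e1] at hc
  have h3 : Real.exp ((hi - lo) ^ 2 / 8) ≤ Real.exp (R ^ 2 / 8) := by
    rw [Real.exp_le_exp]; gcongr
  have h4 := (chord_zero_le hlo hhi hlt).trans h3
  have e2 : (hi - y) / (hi - lo) * Real.exp lo + (y - lo) / (hi - lo) * Real.exp hi
      = (hi / (hi - lo) * Real.exp lo + -lo / (hi - lo) * Real.exp hi) + chordSlope lo hi * y := by
    unfold chordSlope; field_simp; ring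
  linarith

theorem abs_chordSlope_le {lo hi B : ℝ} (h : lo ≤ hi) (hB : hi ≤ B) :
    |chordSlope lo hi| ≤ Real.exp B := by
  unfold chordSlope
  rcases h.eq_or_lt with h | h
  · subst h; simp [(Real.exp_pos B).le]
  have hd : 0 < hi - lo := by linarith
  have h1 : Real.exp lo ≤ Real.exp hi := Real.exp_le_exp.2 h.le
  rw [abs_of_nonneg (div_nonneg (by linarith) hd.le), div_le_iff₀ hd]
  have h2 := Real.add_one_le_exp (lo - hi)
  have h3 : Real.exp lo = Real.exp hi * Real.exp (lo - hi) := by rw [← Real.exp_add]; ring_nf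
  have h4 : Real.exp hi ≤ Real.exp B := Real.exp_le_exp.2 hB
  have := Real.exp_pos hi
  nlinarith

variable {Ω : Type*} [mΩ : MeasurableSpace Ω] {P : Measure Ω}

/-- Exponential moments of a martingale whose differences lie in predictable intervals. -/
theorem integral_exp_sum_le [IsProbabilityMeasure P] {F : ℕ → MeasurableSpace Ω}
    (hF : ∀ s, F s ≤ mΩ) (hmono : Monotone F) {X lo hi : ℕ → Ω → ℝ} {n : ℕ} {B R l : ℝ}
    (hl : 0 ≤ l)
    (hX : ∀ s, Measurable[F (s + 1)] (X s)) (hlom : ∀ s, Measurable[F s] (lo s))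
    (hhim : ∀ s, Measurable[F s] (hi s))
    (hae : ∀ s < n, ∀ᵐ ω ∂P, lo s ω ≤ 0 ∧ 0 ≤ hi s ω ∧ hi s ω - lo s ω ≤ R ∧
      lo s ω ≤ X s ω ∧ X s ω ≤ hi s ω)
    (hB : ∀ s < n, ∀ᵐ ω ∂P, |X s ω| ≤ B)
    (hc : ∀ s < n, P[X s | F s] =ᵐ[P] 0) :
    ∀ t ≤ n, (∃ D, ∀ᵐ ω ∂P, Real.exp (l * ∑ s ∈ Finset.range t, X s ω) ≤ D) ∧
      ∫ ω, Real.exp (l * ∑ s ∈ Finset.range t, X s ω) ∂P ≤ Real.exp (l ^ 2 * R ^ 2 / 8) ^ t := by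
  intro t
  induction t with
  | zero => intro _; simpa using ⟨1, le_rfl⟩
  | succ t ih =>
    intro ht
    obtain ⟨⟨D, hD⟩, hint⟩ := ih (by omega)
    set W : Ω → ℝ := fun ω => Real.exp (l * ∑ s ∈ Finset.range t, X s ω) with hW
    have hWm : Measurable[F t] W := by
      refine Real.measurable_exp.comp (Measurable.const_mul ?_ l)
      exact Finset.measurable_fun_sum _ fun s hs =>
        (hX s).mono (hmono (by have := Finset.mem_range.1 hs; omega)) le_rfl
    have hW0 : ∀ ω, 0 ≤ W ω := fun ω => (Real.exp_pos _).le
    -- The chord slope is known at time `t` and bounded, so it can be pulled out of the conditional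
    -- expectation of `X t` together with `W`.
    set k : Ω → ℝ := fun ω => l * chordSlope (l * lo t ω) (l * hi t ω) with hk
    have hkm : Measurable[F t] k := by
      unfold chordSlope at hk
      refine Measurable.const_mul (Measurable.div ?_ ?_) l
      · exact (Real.measurable_exp.comp ((hhim t).const_mul l)).sub
          (Real.measurable_exp.comp ((hlom t).const_mul l))
      · exact ((hhim t).const_mul l).sub ((hlom t).const_mul l)
    have hkb : ∀ᵐ ω ∂P, |k ω| ≤ l * Real.exp (l * R) := by
      filter_upwards [hae t (by omega)] with ω hω
      obtain ⟨h1, h2, h3, h4, h5⟩ := hω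
      rw [hk, abs_mul, abs_of_nonneg hl]
      refine mul_le_mul_of_nonneg_left ?_ hl
      exact abs_chordSlope_le (mul_le_mul_of_nonneg_left (by linarith) hl)
        (mul_le_mul_of_nonneg_left (by linarith) hl)
    have hXm : Measurable (X t) := (hX t).mono (hF _) le_rfl
    have hXi : Integrable (X t) P :=
      Integrable.of_bound hXm.aestronglyMeasurable B (hB t (by omega))
    have hWi : Integrable W P := by
      refine Integrable.of_bound (hWm.mono (hF t) le_rfl).aestronglyMeasurable D ?_
      filter_upwards [hD] with ω hω
      rwa [Real.norm_of_nonneg (hW0 ω)]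
    have hWk : ∀ᵐ ω ∂P, ‖(W * k) ω‖ ≤ D * (l * Real.exp (l * R)) := by
      filter_upwards [hD, hkb] with ω h1 h2
      rw [Pi.mul_apply, norm_mul, Real.norm_of_nonneg (hW0 ω)]
      exact mul_le_mul h1 h2 (abs_nonneg _) ((hW0 ω).trans h1)
    have hWkX : Integrable (W * k * X t) P :=
      hXi.bdd_mul ((hWm.mul hkm).mono (hF t) le_rfl).aestronglyMeasurable hWk
    have hzero : ∫ ω, (W * k * X t) ω ∂P = 0 := by
      rw [← integral_condExp (hF t)]
      have h := condExp_stronglyMeasurable_mul_of_bound (hF t) (hWm.mul hkm).stronglyMeasurable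
        hXi _ hWk
      rw [integral_congr_ae (h.trans (Filter.EventuallyEq.mul (Filter.EventuallyEq.refl _ _)
        (hc t (by omega))))]
      simp
    have hle : ∀ᵐ ω ∂P, Real.exp (l * ∑ s ∈ Finset.range (t + 1), X s ω)
        ≤ Real.exp (l ^ 2 * R ^ 2 / 8) * W ω + (W * k * X t) ω := by
      filter_upwards [hae t (by omega)] with ω hω
      obtain ⟨h1, h2, h3, h4, h5⟩ := hω
      have h := exp_le_add_chordSlope_mul (lo := l * lo t ω) (hi := l * hi t ω)
        (y := l * X t ω) (R := l * R) (mul_nonpos_of_nonneg_of_nonpos hl h1) (mul_nonneg hl h2)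
        (by rw [← mul_sub]; exact mul_le_mul_of_nonneg_left h3 hl)
        (mul_le_mul_of_nonneg_left h4 hl) (mul_le_mul_of_nonneg_left h5 hl)
      rw [mul_pow] at h
      rw [Finset.sum_range_succ, mul_add, Real.exp_add]
      have h' := mul_le_mul_of_nonneg_left h (hW0 ω)
      simp only [Pi.mul_apply, hk]
      simp only [hW] at h' ⊢
      linarith
    have hXs : Measurable fun ω => Real.exp (l * ∑ s ∈ Finset.range (t + 1), X s ω) := by
      refine Real.measurable_exp.comp (Measurable.const_mul ?_ l)
      exact Finset.measurable_fun_sum _ fun s _ => (hX s).mono (hF _) le_rfl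
    have hbd : ∀ᵐ ω ∂P, Real.exp (l * ∑ s ∈ Finset.range (t + 1), X s ω)
        ≤ D * Real.exp (l * B) := by
      filter_upwards [hD, hB t (by omega)] with ω h1 h2
      rw [Finset.sum_range_succ, mul_add, Real.exp_add]
      refine mul_le_mul h1 ?_ (Real.exp_pos _).le ((hW0 ω).trans h1)
      exact Real.exp_le_exp.2 (mul_le_mul_of_nonneg_left ((le_abs_self _).trans h2) hl)
    refine ⟨⟨_, hbd⟩, ?_⟩
    have hi' : Integrable (fun ω => Real.exp (l * ∑ s ∈ Finset.range (t + 1), X s ω)) P := by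
      refine Integrable.of_bound hXs.aestronglyMeasurable (D * Real.exp (l * B)) ?_
      filter_upwards [hbd] with ω hω
      rwa [Real.norm_of_nonneg (Real.exp_pos _).le]
    refine (integral_mono_ae hi' ((hWi.const_mul _).add hWkX) hle).trans ?_
    rw [integral_add' (hWi.const_mul _) hWkX, hzero, add_zero, integral_const_mul, pow_succ' _ t]
    exact mul_le_mul_of_nonneg_left hint (Real.exp_pos _).le

theorem measureReal_sum_ge_le [IsProbabilityMeasure P] {F : ℕ → MeasurableSpace Ω}
    (hF : ∀ s, F s ≤ mΩ) (hmono : Monotone F) {X lo hi : ℕ → Ω → ℝ} {n : ℕ} {B R x : ℝ}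
    (hR : 0 < R) (hx : 0 ≤ x)
    (hX : ∀ s, Measurable[F (s + 1)] (X s)) (hlom : ∀ s, Measurable[F s] (lo s))
    (hhim : ∀ s, Measurable[F s] (hi s))
    (hae : ∀ s < n, ∀ᵐ ω ∂P, lo s ω ≤ 0 ∧ 0 ≤ hi s ω ∧ hi s ω - lo s ω ≤ R ∧
      lo s ω ≤ X s ω ∧ X s ω ≤ hi s ω)
    (hB : ∀ s < n, ∀ᵐ ω ∂P, |X s ω| ≤ B)
    (hc : ∀ s < n, P[X s | F s] =ᵐ[P] 0) (hn : 0 < n) :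
    P.real {ω | x ≤ ∑ s ∈ Finset.range n, X s ω} ≤ Real.exp (-(2 * x ^ 2) / (n * R ^ 2)) := by
  have hn' : (0 : ℝ) < n := by exact_mod_cast hn
  -- The minimizer of `n * l ^ 2 * R ^ 2 / 8 - l * x`.
  set l : ℝ := 4 * x / (n * R ^ 2) with hl
  have hl0 : 0 ≤ l := by positivity
  obtain ⟨⟨D, hD⟩, hint⟩ := integral_exp_sum_le hF hmono hl0 hX hlom hhim hae hB hc n le_rfl
  have hXs : Measurable fun ω => Real.exp (l * ∑ s ∈ Finset.range n, X s ω) := by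
    refine Real.measurable_exp.comp (Measurable.const_mul ?_ l)
    exact Finset.measurable_fun_sum _ fun s _ => (hX s).mono (hF _) le_rfl
  have h := measure_ge_le_exp_mul_mgf (μ := P) (X := fun ω => ∑ s ∈ Finset.range n, X s ω)
    (t := l) x hl0 (by
      refine Integrable.of_bound hXs.aestronglyMeasurable D ?_
      filter_upwards [hD] with ω hω
      rwa [Real.norm_of_nonneg (Real.exp_pos _).le])
  refine h.trans ((mul_le_mul_of_nonneg_left hint (Real.exp_pos _).le).trans (le_of_eq ?_))
  rw [← Real.exp_nat_mul, ← Real.exp_add]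
  congr 1
  rw [hl]
  field_simp
  ring

/-- **Azuma–Hoeffding inequality** with predictable intervals. -/
theorem measureReal_abs_sum_ge_le [IsProbabilityMeasure P] {F : ℕ → MeasurableSpace Ω}
    (hF : ∀ s, F s ≤ mΩ) (hmono : Monotone F) {X lo hi : ℕ → Ω → ℝ} {n : ℕ} {B R x : ℝ}
    (hR : 0 < R) (hx : 0 ≤ x)
    (hX : ∀ s, Measurable[F (s + 1)] (X s)) (hlom : ∀ s, Measurable[F s] (lo s))
    (hhim : ∀ s, Measurable[F s] (hi s))
    (hae : ∀ s < n, ∀ᵐ ω ∂P, lo s ω ≤ 0 ∧ 0 ≤ hi s ω ∧ hi s ω - lo s ω ≤ R ∧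
      lo s ω ≤ X s ω ∧ X s ω ≤ hi s ω)
    (hB : ∀ s < n, ∀ᵐ ω ∂P, |X s ω| ≤ B)
    (hc : ∀ s < n, P[X s | F s] =ᵐ[P] 0) (hn : 0 < n) :
    P.real {ω | x ≤ |∑ s ∈ Finset.range n, X s ω|}
      ≤ 2 * Real.exp (-(2 * x ^ 2) / (n * R ^ 2)) := by
  have h1 := measureReal_sum_ge_le hF hmono hR hx hX hlom hhim hae hB hc hn
  have h2 := measureReal_sum_ge_le (P := P) hF hmono hR hx (X := fun s => -X s)
    (lo := fun s => -hi s) (hi := fun s => -lo s) (fun s => (hX s).neg) (fun s => (hhim s).neg)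
    (fun s => (hlom s).neg) (fun s hs => by
      filter_upwards [hae s hs] with ω ⟨a, b, c, d, e⟩
      simp only [Pi.neg_apply]
      refine ⟨?_, ?_, ?_, ?_, ?_⟩ <;> linarith)
    (fun s hs => by
      filter_upwards [hB s hs] with ω h
      rwa [Pi.neg_apply, abs_neg])
    (fun s hs => by
      refine (condExp_neg (X s) (F s)).trans ?_
      filter_upwards [hc s hs] with ω h
      simp [h]) hn
  have hsub : {ω | x ≤ |∑ s ∈ Finset.range n, X s ω|} ⊆
      {ω | x ≤ ∑ s ∈ Finset.range n, X s ω} ∪ {ω | x ≤ ∑ s ∈ Finset.range n, (-X s) ω} := by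
    intro ω hω
    simp only [Set.mem_ofPred_eq, Set.mem_union, Pi.neg_apply, Finset.sum_neg_distrib] at hω ⊢
    exact le_abs.1 hω
  have h3 := (measureReal_mono (μ := P) hsub).trans (measureReal_union_le _ _)
  linarith

end

/-! ### Deterministic analysis of a path. -/

section

/-- Only the `1 / γ` summand of `kappa` is needed; the others are discarded. -/
theorem sq_mul_sq_le_of_kappa_le {M γ κ : ℝ} (hγ : 0 < γ) (hκ : kappa M γ ≤ κ) :
    48 * M ^ 2 ≤ κ ^ 2 * γ ^ 2 := by
  have h1 : kappa M γ ^ 2 ≤ κ ^ 2 := pow_le_pow_left₀ (Real.sqrt_nonneg _) hκ 2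
  have hs := Real.sqrt_nonneg γ
  rw [kappa, Real.sq_sqrt (by positivity)] at h1
  have h2 := mul_le_mul_of_nonneg_right h1 (sq_nonneg γ)
  refine le_trans ?_ h2
  have e : (48 * M ^ 2 * (2 + 2 / √γ + 1 / γ) + 12 * M ^ 2) / γ * γ ^ 2
      = 48 * M ^ 2 + (48 * M ^ 2 * (2 + 2 / √γ) + 12 * M ^ 2) * γ := by
    field_simp
    ring
  rw [e]
  have : 0 ≤ (48 * M ^ 2 * (2 + 2 / √γ) + 12 * M ^ 2) * γ := by positivity
  linarith

theorem kappa_pos {M γ : ℝ} (hγ : 0 < γ) (hM : 0 < M) : 0 < kappa M γ := by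
  have := Real.sqrt_pos.2 hγ
  exact Real.sqrt_pos.2 (by positivity)

/-- A bound on the weighted sum of deviations turns into a bound in units of the estimated
standard deviation. -/
theorem abs_weighted_mean_sub_le {n : ℕ} (hn : 0 < n) {p g : ℕ → ℝ} {γ M κ L μ : ℝ} (hγ : 0 < γ)
    (hM : 0 < M) (hκ0 : 0 < κ) (hL : 0 ≤ L) (hk : 48 * M ^ 2 ≤ κ ^ 2 * γ ^ 2)
    (hp : ∀ s < n, γ / 2 ≤ p s) (m : ℝ)
    (hS : |∑ s ∈ Finset.range n, √(p s) * (g s - μ)| ≤ M * √(12 * n * L / γ)) :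
    |(∑ s ∈ Finset.range n, √(p s) * g s) / (∑ s ∈ Finset.range n, √(p s)) - μ| ≤
      √L * κ * √((∑ s ∈ Finset.range n, p s * ((g s - m) ^ 2 + 1)) /
        (∑ s ∈ Finset.range n, √(p s)) ^ 2 / 2) := by
  have hn' : (0 : ℝ) < n := by exact_mod_cast hn
  set W := ∑ s ∈ Finset.range n, √(p s) with hW
  set N := ∑ s ∈ Finset.range n, p s * ((g s - m) ^ 2 + 1) with hN
  have hW0 : 0 < W := Finset.sum_pos
    (fun s hs => Real.sqrt_pos.2 (by have := hp s (Finset.mem_range.1 hs); linarith))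
    ⟨0, Finset.mem_range.2 hn⟩
  -- The auxiliary `+ 1` alone gives this, so the centre `m` plays no role.
  have hNle : n * (γ / 2) ≤ N := by
    have := Finset.card_nsmul_le_sum (Finset.range n) (fun s => p s * ((g s - m) ^ 2 + 1)) (γ / 2)
      (fun s hs => by
        have := hp s (Finset.mem_range.1 hs)
        nlinarith [mul_nonneg (by linarith : 0 ≤ p s) (sq_nonneg (g s - m))])
    simpa using this
  have hNpos : 0 < N := lt_of_lt_of_le (by positivity) hNle
  have e1 : (∑ s ∈ Finset.range n, √(p s) * g s) / W - μ
      = (∑ s ∈ Finset.range n, √(p s) * (g s - μ)) / W := by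
    simp only [mul_sub, Finset.sum_sub_distrib, ← Finset.sum_mul]
    rw [← hW]
    field_simp
  have e2 : √(N / W ^ 2 / 2) = √(N / 2) / W := by
    rw [div_right_comm, Real.sqrt_div (by positivity), Real.sqrt_sq hW0.le]
  rw [e1, e2, abs_div, abs_of_pos hW0, ← mul_div_assoc]
  refine div_le_div_of_nonneg_right (hS.trans ?_) hW0.le
  refine abs_le_of_sq_le_sq' ?_ (by positivity) |>.2
  rw [mul_pow, mul_pow, mul_pow, Real.sq_sqrt (by positivity), Real.sq_sqrt hL,
    Real.sq_sqrt (by positivity)]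
  have h3 : M ^ 2 * (12 * n * L / γ) = 48 * M ^ 2 * (n * L / (4 * γ)) := by field_simp; ring
  have h4 : L * κ ^ 2 * (n * (γ / 2) / 2) = κ ^ 2 * γ ^ 2 * (n * L / (4 * γ)) := by
    field_simp; ring
  calc M ^ 2 * (12 * n * L / γ) = 48 * M ^ 2 * (n * L / (4 * γ)) := h3
    _ ≤ κ ^ 2 * γ ^ 2 * (n * L / (4 * γ)) := by gcongr
    _ = L * κ ^ 2 * (n * (γ / 2) / 2) := h4.symm
    _ ≤ L * κ ^ 2 * (N / 2) := by gcongr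

theorem abs_weighted_mean_le {n : ℕ} {w g : ℕ → ℝ} {B : ℝ} (hB : 0 ≤ B)
    (hw : ∀ s < n, 0 ≤ w s) (hg : ∀ s < n, |g s| ≤ B) :
    |(∑ s ∈ Finset.range n, w s * g s) / (∑ s ∈ Finset.range n, w s)| ≤ B := by
  have hW : 0 ≤ ∑ s ∈ Finset.range n, w s :=
    Finset.sum_nonneg fun s hs => hw s (Finset.mem_range.1 hs)
  rw [abs_div, abs_of_nonneg hW]
  refine div_le_of_le_mul₀ hW hB ?_
  rw [Finset.mul_sum]
  refine (Finset.abs_sum_le_sum_abs _ _).trans (Finset.sum_le_sum fun s hs => ?_)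
  have hs := Finset.mem_range.1 hs
  rw [abs_mul, abs_of_nonneg (hw s hs), mul_comm B]
  exact mul_le_mul_of_nonneg_left (hg s hs) (hw s hs)

theorem weighted_variance_le {n : ℕ} (hn : 0 < n) {p g : ℕ → ℝ} {γ B m : ℝ} (hγ : 0 < γ)
    (hp : ∀ s < n, γ / 2 ≤ p s ∧ p s ≤ 1) (hg : ∀ s < n, |g s| ≤ B) (hm : |m| ≤ B) :
    (∑ s ∈ Finset.range n, p s * ((g s - m) ^ 2 + 1)) / (∑ s ∈ Finset.range n, √(p s)) ^ 2
      ≤ 2 * (4 * B ^ 2 + 1) / γ / n := by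
  have hn' : (0 : ℝ) < n := by exact_mod_cast hn
  have h1 : ∑ s ∈ Finset.range n, p s * ((g s - m) ^ 2 + 1) ≤ n * (4 * B ^ 2 + 1) := by
    have := Finset.sum_le_card_nsmul (Finset.range n) (fun s => p s * ((g s - m) ^ 2 + 1))
      (4 * B ^ 2 + 1) (fun s hs => by
        obtain ⟨h1, h2⟩ := hp s (Finset.mem_range.1 hs)
        have h3 := abs_le.1 (hg s (Finset.mem_range.1 hs))
        have h4 := abs_le.1 hm
        have h5 : (g s - m) ^ 2 ≤ (2 * B) ^ 2 := sq_le_sq' (by linarith) (by linarith)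
        nlinarith [mul_nonneg (sub_nonneg.2 h2) (by positivity : 0 ≤ (g s - m) ^ 2 + 1)])
    simpa [mul_add] using this
  have h2 : n * √(γ / 2) ≤ ∑ s ∈ Finset.range n, √(p s) := by
    have := Finset.card_nsmul_le_sum (Finset.range n) (fun s => √(p s)) (√(γ / 2))
      (fun s hs => Real.sqrt_le_sqrt (hp s (Finset.mem_range.1 hs)).1)
    simpa using this
  have h3 : (n : ℝ) ^ 2 * (γ / 2) ≤ (∑ s ∈ Finset.range n, √(p s)) ^ 2 := by
    have := pow_le_pow_left₀ (by positivity) h2 2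
    rwa [mul_pow, Real.sq_sqrt (by positivity)] at this
  calc _ ≤ n * (4 * B ^ 2 + 1) / ((n : ℝ) ^ 2 * (γ / 2)) := by gcongr
    _ = _ := by field_simp

theorem weighted_variance_pos {n : ℕ} (hn : 0 < n) {p g : ℕ → ℝ} {m : ℝ}
    (hp : ∀ s < n, 0 < p s) :
    0 < (∑ s ∈ Finset.range n, p s * ((g s - m) ^ 2 + 1)) /
      (∑ s ∈ Finset.range n, √(p s)) ^ 2 := by
  have h1 : 0 < ∑ s ∈ Finset.range n, √(p s) := Finset.sum_pos
    (fun s hs => Real.sqrt_pos.2 (hp s (Finset.mem_range.1 hs))) ⟨0, Finset.mem_range.2 hn⟩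
  refine div_pos (Finset.sum_pos (fun s hs => ?_) ⟨0, Finset.mem_range.2 hn⟩) (by positivity)
  have := hp s (Finset.mem_range.1 hs)
  positivity

variable {K : ℕ}

theorem Path.abs_avg_le (h : Path K) {M : ℝ} {t : ℕ} {b : Fin K} (hi : |h.init b| ≤ M)
    (hr : ∀ s < t, |h.reward s| ≤ M) : |h.avg t b| ≤ M := by
  have hc : (0 : ℝ) < h.count t b := by unfold Path.count; positivity
  rw [Path.avg, abs_div, abs_of_pos hc, div_le_iff₀ hc]
  refine (abs_add_le _ _).trans ?_
  have h1 : |∑ s ∈ Finset.range t, if h.arm s = b then h.reward s else 0|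
      ≤ ((Finset.range t).filter fun s => h.arm s = b).card * M := by
    rw [← Finset.sum_filter]
    refine (Finset.abs_sum_le_sum_abs _ _).trans ?_
    have := Finset.sum_le_card_nsmul ((Finset.range t).filter fun s => h.arm s = b)
      (fun s => |h.reward s|) M
      (fun s hs => hr s (Finset.mem_range.1 (Finset.mem_filter.1 hs).1))
    simpa using this
  rw [Path.count]
  push_cast
  linarith

theorem Path.abs_score_le (h : Path K) {M γ : ℝ} (hγ : 0 < γ) (hM : 0 < M) {p : ℕ → Fin K → ℝ}
    {s : ℕ} {b : Fin K} (hi : |h.init b| ≤ M) (hr : ∀ u ≤ s, |h.reward u| ≤ M)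
    (hp : γ / 2 ≤ p s b) : |h.score p s b| ≤ M + 4 * M / γ := by
  have ha := h.abs_avg_le hi fun u hu => hr u hu.le
  unfold Path.score
  refine (abs_add_le _ _).trans (add_le_add ha ?_)
  split_ifs
  · rw [abs_div, abs_of_pos (show 0 < p s b by linarith)]
    have h1 : |h.reward s - h.avg s b| ≤ 2 * M := by
      have h2 := abs_le.1 (hr s le_rfl)
      have h3 := abs_le.1 ha
      exact abs_le.2 ⟨by linarith, by linarith⟩
    calc _ ≤ 2 * M / (γ / 2) := by gcongr
      _ = _ := by field_simp; ring
  · simp; positivity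

theorem propensity_le_one {γ κ : ℝ} (h0 : 0 ≤ γ) (h1 : γ ≤ 1) (A : Finset (Fin K))
    (m v : Fin K → ℝ) (b : Fin K) : propensity γ κ A m v b ≤ 1 := by
  unfold propensity
  split_ifs with hb
  · have h2 : thompson κ A m v b ≤ 1 := measureReal_le_one
    have h3 : (1 : ℝ) ≤ A.card := by exact_mod_cast Finset.card_pos.2 ⟨b, hb⟩
    have h4 : γ / A.card ≤ γ := div_le_self h0 h3
    nlinarith
  · exact zero_le_one

theorem le_propensity {γ κ : ℝ} (h0 : 0 ≤ γ) (h1 : γ ≤ 1) {A : Finset (Fin K)}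
    (m v : Fin K → ℝ) {b : Fin K} (hb : b ∈ A) : γ / K ≤ propensity γ κ A m v b := by
  unfold propensity
  rw [if_pos hb]
  have h2 : 0 ≤ thompson κ A m v b := measureReal_nonneg
  have h3 : (0 : ℝ) < A.card := by exact_mod_cast Finset.card_pos.2 ⟨b, hb⟩
  have h4 : (A.card : ℝ) ≤ K := by exact_mod_cast A.card_le_univ.trans (by simp)
  have h5 : γ / K ≤ γ / A.card := by gcongr
  have := mul_nonneg (sub_nonneg.2 h1) h2
  linarith

theorem Path.prop_le_one (h : Path K) (T : ℕ) {γ κ : ℝ} (h0 : 0 ≤ γ) (h1 : γ ≤ 1) (t : ℕ)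
    (b : Fin K) : h.prop T γ κ t b ≤ 1 := by
  cases t with
  | zero =>
    rw [Path.prop_zero]
    have : (1 : ℝ) ≤ K := by exact_mod_cast (Fin.pos b)
    exact div_le_one_of_le₀ this (by positivity)
  | succ t => rw [Path.prop_succ]; exact propensity_le_one h0 h1 _ _ _ _

theorem Path.le_prop (h : Path K) (T : ℕ) {γ κ : ℝ} (h0 : 0 ≤ γ) (h1 : γ ≤ 1) {t : ℕ}
    {b : Fin K} (hb : b ∈ h.active T γ κ t) : γ / K ≤ h.prop T γ κ t b := by
  cases t with
  | zero => rw [Path.prop_zero]; gcongr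
  | succ t => rw [Path.prop_succ]; exact le_propensity h0 h1 _ _ hb

theorem Path.prop_eq_zero (h : Path K) (T : ℕ) {γ κ : ℝ} {t : ℕ}
    {b : Fin K} (hb : b ∉ h.active T γ κ t) : h.prop T γ κ t b = 0 := by
  cases t with
  | zero => simp [Path.active_zero] at hb
  | succ t => rw [Path.prop_succ, propensity, if_neg hb]

theorem Path.active_antitone (h : Path K) (T : ℕ) (γ κ : ℝ) : Antitone (h.active T γ κ) := by
  refine antitone_nat_of_succ_le fun t => ?_
  rw [Path.active_succ]
  exact Finset.filter_subset _ _

/-- While all arms have been eligible and the weighted deviation sums are controlled, the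
estimates are accurate on the scale of the estimated standard deviations, which are of order
`1 / √t`. -/
theorem Path.estimates (h : Path 2) {T t : ℕ} (ht : 0 < t) {γ M κ L : ℝ} {μ : Fin 2 → ℝ}
    (hγ0 : 0 < γ) (hγ1 : γ < 1) (hM : 0 < M) (hκ : kappa M γ ≤ κ) (hL : 0 ≤ L)
    (hi : ∀ b, |h.init b| ≤ M) (hr : ∀ s < t, |h.reward s| ≤ M)
    (hact : ∀ s < t, h.active T γ κ s = Finset.univ)
    (hS : ∀ b, |∑ s ∈ Finset.range t, √(h.prop T γ κ s b) *
      (h.score (h.prop T γ κ) s b - μ b)| ≤ M * √(12 * t * L / γ)) (b : Fin 2) :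
    |h.muHat (h.prop T γ κ) t b - μ b| ≤ √L * κ * √(h.varHat (h.prop T γ κ) t b / 2) ∧
    0 < h.varHat (h.prop T γ κ) t b ∧
    h.varHat (h.prop T γ κ) t b ≤ 2 * (4 * (M + 4 * M / γ) ^ 2 + 1) / γ / t := by
  have hp : ∀ s < t, γ / 2 ≤ h.prop T γ κ s b := fun s hs => by
    have := h.le_prop T (κ := κ) hγ0.le hγ1.le (t := s) (b := b) (by rw [hact s hs]; simp)
    simpa using this
  have hg : ∀ s < t, |h.score (h.prop T γ κ) s b| ≤ M + 4 * M / γ := fun s hs =>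
    h.abs_score_le hγ0 hM (hi b) (fun u hu => hr u (by omega)) (hp s hs)
  refine ⟨?_, ?_, ?_⟩
  · exact abs_weighted_mean_sub_le ht hγ0 hM ((kappa_pos hγ0 hM).trans_le hκ) hL
      (sq_mul_sq_le_of_kappa_le hγ0 hκ) hp _ (hS b)
  · exact weighted_variance_pos ht fun s hs => by have := hp s hs; linarith
  · exact weighted_variance_le ht hγ0 (fun s hs => ⟨hp s hs, h.prop_le_one T hγ0.le hγ1.le s b⟩)
      hg (abs_weighted_mean_le (by positivity) (fun s _ => Real.sqrt_nonneg _) hg)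

/-- Combines the errors of the two arms into the standard deviation of the difference; this is why
the individual bounds carry `varHat / 2`. -/
theorem sqrt_half_add_sqrt_half_le {v w : ℝ} (hv : 0 ≤ v) (hw : 0 ≤ w) :
    √(v / 2) + √(w / 2) ≤ √(v + w) := by
  refine Real.le_sqrt_of_sq_le ?_
  have h1 := Real.sq_sqrt (show 0 ≤ v / 2 by positivity)
  have h2 := Real.sq_sqrt (show 0 ≤ w / 2 by positivity)
  nlinarith [sq_nonneg (√(v / 2) - √(w / 2))]

/-- The optimal arm `i` is never removed, and the other arm `j` is kept after `t` rounds only if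
its gap is of order `√(log T / t)`. -/
theorem Path.best_mem_active (h : Path 2) {T : ℕ} {γ M κ : ℝ} {μ : Fin 2 → ℝ}
    (hγ0 : 0 < γ) (hγ1 : γ < 1) (hM : 0 < M) (hκ : kappa M γ ≤ κ) (hT : Real.exp 16 ≤ T)
    (hi : ∀ b, |h.init b| ≤ M) (hr : ∀ s < T, |h.reward s| ≤ M)
    (hS : ∀ t < T, (∀ s < t, h.active T γ κ s = Finset.univ) → ∀ b,
      |∑ s ∈ Finset.range t, √(h.prop T γ κ s b) *
      (h.score (h.prop T γ κ) s b - μ b)| ≤ M * √(12 * t * Real.log T / γ))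
    {i j : Fin 2} (hij : i ≠ j) (hμ : μ j ≤ μ i) :
    ∀ t < T, i ∈ h.active T γ κ t ∧ (0 < t → j ∈ h.active T γ κ t →
      μ i - μ j ≤ 3 * κ * √(4 * (4 * (M + 4 * M / γ) ^ 2 + 1) / γ) *
        √(Real.log T) * (1 / √t)) := by
  have hκ0 : 0 < κ := (kappa_pos hγ0 hM).trans_le hκ
  have hT0 : (0 : ℝ) < T := (Real.exp_pos _).trans_le hT
  have hL16 : 16 ≤ Real.log T := by rwa [Real.le_log_iff_exp_le hT0]
  have hL : 0 ≤ Real.log T := by linarith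
  have huniv : ∀ A : Finset (Fin 2), i ∈ A → j ∈ A → A = Finset.univ := by
    intro A h1 h2
    ext x
    simp only [Finset.mem_univ, iff_true]
    have : x = i ∨ x = j := by omega
    rcases this with rfl | rfl <;> assumption
  intro t
  induction t with
  | zero => intro _; simp [Path.active_zero]
  | succ t ih =>
    intro ht
    have hit := (ih (by omega)).1
    have hself : 1 / (T : ℝ) ≤ cdf (gaussianReal 0 1) 0 :=
      (one_div_le_cdf_neg_sqrt_log hT).trans (monotone_cdf _ (by simp))
    -- Estimates are controlled only while both arms are eligible. Once `j` is gone, `i` is compared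
    -- with itself alone and survives because `Φ(0) ≥ 1 / T`.
    by_cases hj : j ∈ h.active T γ κ t
    · have hall : ∀ s < t + 1, h.active T γ κ s = Finset.univ := fun s hs => by
        have hs' : s ≤ t := by omega
        exact huniv _ (h.active_antitone T γ κ hs' hit) (h.active_antitone T γ κ hs' hj)
      have hest := h.estimates (T := T) (κ := κ) (Nat.succ_pos t) hγ0 hγ1 hM hκ hL hi
        (fun s hs => hr s (by omega)) hall (hS (t + 1) ht hall)
      rw [Path.active_succ]
      obtain ⟨hmi, hvi, hVi⟩ := hest i
      obtain ⟨hmj, hvj, hVj⟩ := hest j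
      set m := h.muHat (h.prop T γ κ) (t + 1)
      set v := h.varHat (h.prop T γ κ) (t + 1)
      have hq := mul_le_mul_of_nonneg_left (sqrt_half_add_sqrt_half_le hvi.le hvj.le)
        (mul_nonneg (Real.sqrt_nonneg (Real.log T)) hκ0.le)
      rw [mul_add] at hq
      have hmi' := abs_le.1 hmi
      have hmj' := abs_le.1 hmj
      have hσ : 0 < √(v i + v j) := Real.sqrt_pos.2 (by linarith)
      constructor
      · rw [survivors, Finset.mem_filter]
        refine ⟨hit, fun b' _ => ?_⟩
        have : b' = i ∨ b' = j := by omega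
        rcases this with rfl | rfl
        · simpa using hself
        · refine (one_div_le_cdf_neg_sqrt_log hT).trans (monotone_cdf _ ?_)
          rw [le_div_iff₀ (by positivity)]
          linarith
      · intro _ hjm
        rw [survivors, Finset.mem_filter] at hjm
        have h1 := neg_sqrt_two_log_le_of_le_cdf hT0 (hjm.2 i hit)
        rw [le_div_iff₀ (by positivity), add_comm (v j)] at h1
        -- The factor `3` in the gap is this `2` from survival plus `1` from the estimation error.
        have h2 : √(2 * Real.log T) ≤ 2 * √(Real.log T) := by
          rw [Real.sqrt_le_left (by positivity), mul_pow, Real.sq_sqrt hL]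
          linarith
        have h3 := mul_le_mul_of_nonneg_right h2 (mul_nonneg hκ0.le hσ.le)
        have h4 : √(v i + v j) ≤ √(4 * (4 * (M + 4 * M / γ) ^ 2 + 1) / γ) *
            (1 / √((t + 1 : ℕ) : ℝ)) := by
          rw [mul_one_div, ← Real.sqrt_div (by positivity)]
          refine Real.sqrt_le_sqrt ((add_le_add hVi hVj).trans (le_of_eq ?_))
          ring
        have h5 := mul_le_mul_of_nonneg_left h4
          (mul_nonneg (mul_nonneg zero_le_three hκ0.le) (Real.sqrt_nonneg (Real.log T)))
        linarith
    · have hA : ∀ b' ∈ h.active T γ κ t, b' = i := fun b' hb' => by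
        by_contra hne
        have : b' = j := by omega
        exact hj (this ▸ hb')
      constructor
      · rw [Path.active_succ, survivors, Finset.mem_filter]
        refine ⟨hit, fun b' hb' => ?_⟩
        rw [hA b' hb']
        simpa using hself
      · intro _ hjm
        exact absurd (h.active_antitone T γ κ (Nat.le_succ t) hjm) hj

/-- Telescoping: each term is at most `2 * √(n + 1) - 2 * √n`. -/
theorem sum_one_div_sqrt_le (n : ℕ) :
    ∑ t ∈ Finset.range n, 1 / √((t + 1 : ℕ) : ℝ) ≤ 2 * √n := by
  induction n with
  | zero => simp
  | succ n ih =>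
    rw [Finset.sum_range_succ]
    have h0 : 0 < √((n + 1 : ℕ) : ℝ) := Real.sqrt_pos.2 (by positivity)
    have h1 := Real.sq_sqrt (show (0 : ℝ) ≤ (n + 1 : ℕ) by positivity)
    have h2 := Real.sq_sqrt (show (0 : ℝ) ≤ n by positivity)
    have h3 : 1 / √((n + 1 : ℕ) : ℝ) ≤ 2 * √((n + 1 : ℕ) : ℝ) - 2 * √n := by
      rw [div_le_iff₀ h0]
      push_cast at h1 ⊢
      nlinarith [sq_nonneg (√((n : ℝ) + 1) - √(n : ℝ))]
    linarith

end

/-! ### Measurability, and the martingale of weighted deviations. -/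

section

variable {Ω : Type*} {K : ℕ}
  {init : Fin K → Ω → ℝ} {r : ℕ → Fin K → Ω → ℝ} {a : ℕ → Ω → Fin K}

theorem history_mono : Monotone (history init r a) := by
  intro s t hst
  refine sup_le_sup_left (biSup_mono fun u hu => ?_) _
  simp only [Finset.mem_range] at hu ⊢
  omega

theorem measurable_init_history (t : ℕ) (b : Fin K) : Measurable[history init r a t] (init b) :=
  measurable_iff_comap_le.2 ((le_iSup (fun b => MeasurableSpace.comap (init b) inferInstance) b).trans
    le_sup_left)

theorem measurable_arm_history {s t : ℕ} (h : s < t) : Measurable[history init r a t] (a s) :=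
  measurable_iff_comap_le.2 ((le_sup_left.trans (le_iSup₂_of_le (f := fun s _ =>
    MeasurableSpace.comap (a s) ⊤ ⊔ MeasurableSpace.comap (fun ω => r s (a s ω) ω) inferInstance)
    s (Finset.mem_range.2 h) le_rfl)).trans le_sup_right)

theorem measurable_reward_history {s t : ℕ} (h : s < t) :
    Measurable[history init r a t] fun ω => r s (a s ω) ω :=
  measurable_iff_comap_le.2 ((le_sup_right.trans (le_iSup₂_of_le (f := fun s _ =>
    MeasurableSpace.comap (a s) ⊤ ⊔ MeasurableSpace.comap (fun ω => r s (a s ω) ω) inferInstance)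
    s (Finset.mem_range.2 h) le_rfl)).trans le_sup_right)

theorem Path.count_eq_sum (h : Path K) (t : ℕ) (b : Fin K) :
    (h.count t b : ℝ) = 1 + ∑ s ∈ Finset.range t, if h.arm s = b then 1 else 0 := by
  simp [Path.count]

theorem measurable_avg_history (t : ℕ) (b : Fin K) :
    Measurable[history init r a t] fun ω => (pathOf init r a ω).avg t b := by
  have hset : ∀ s < t, MeasurableSet[history init r a t] {ω | a s ω = b} := fun s hs =>
    measurable_arm_history hs (measurableSet_singleton b)
  simp only [Path.avg, Path.count_eq_sum, pathOf]
  refine Measurable.div (Measurable.add (measurable_init_history t b) ?_)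
    (Measurable.const_add ?_ 1)
  · exact Finset.measurable_fun_sum _ fun s hs => Measurable.ite (hset s (Finset.mem_range.1 hs))
      (measurable_reward_history (Finset.mem_range.1 hs)) measurable_const
  · exact Finset.measurable_fun_sum _ fun s hs => Measurable.ite (hset s (Finset.mem_range.1 hs))
      measurable_const measurable_const

/-- Condition first on the larger `G`, where the indicator is known and `f` averages to its mean,
then descend to `F` by the tower property. Here `G` is the history together with the arm just
chosen. -/
theorem condExp_indicator_mul_of_indep {F G m : MeasurableSpace Ω} {mΩ : MeasurableSpace Ω}
    {P : Measure Ω} [IsProbabilityMeasure P] (hFG : F ≤ G) (hG : G ≤ mΩ) (hm : m ≤ mΩ)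
    {E : Set Ω} (hE : MeasurableSet[G] E) {f : Ω → ℝ} (hf : StronglyMeasurable[m] f)
    (hfi : Integrable f P) (hind : Indep m G P) :
    P[(E.indicator fun _ => 1) * f | F] =ᵐ[P] fun ω => (∫ x, f x ∂P) * (P⟦E | F⟧) ω := by
  have h1 : P[f | G] =ᵐ[P] fun _ => ∫ x, f x ∂P := condExp_indep_eq hm hG hf hind
  have hJ : StronglyMeasurable[G] (E.indicator fun _ => (1 : ℝ)) :=
    stronglyMeasurable_const.indicator hE
  have h2 : P[(E.indicator fun _ => 1) * f | G] =ᵐ[P]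
      (∫ x, f x ∂P) • (E.indicator fun _ => (1 : ℝ)) := by
    refine (condExp_stronglyMeasurable_mul_of_bound hG hJ hfi 1 (ae_of_all _ fun ω => ?_)).trans ?_
    · by_cases h : ω ∈ E <;> simp [h]
    · filter_upwards [h1] with ω h
      rw [Pi.mul_apply, h, Pi.smul_apply, smul_eq_mul, mul_comm]
  refine (condExp_condExp_of_le hFG hG).symm.trans ((condExp_congr_ae h2).trans ?_)
  exact condExp_smul _ _ _

variable [mΩ : MeasurableSpace Ω] {P : Measure Ω}

/-- The observable version of the propensity of arm `b` in round `s`. -/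
noncomputable def condProp (P : Measure Ω) (init : Fin K → Ω → ℝ) (r : ℕ → Fin K → Ω → ℝ)
    (a : ℕ → Ω → Fin K) (s : ℕ) (b : Fin K) : Ω → ℝ :=
  P⟦a s ⁻¹' {b} | history init r a s⟧

theorem measurable_condProp (s : ℕ) (b : Fin K) :
    Measurable[history init r a s] (condProp P init r a s b) :=
  stronglyMeasurable_condExp.measurable

/-- Predictable part of the weighted deviation of the score. -/
noncomputable def devBase (P : Measure Ω) (init : Fin K → Ω → ℝ) (r : ℕ → Fin K → Ω → ℝ)
    (a : ℕ → Ω → Fin K) (γ μ : ℝ) (b : Fin K) (s : ℕ) (ω : Ω) : ℝ :=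
  if γ / 2 ≤ condProp P init r a s b ω then
    √(condProp P init r a s b ω) * ((pathOf init r a ω).avg s b - μ) else 0

/-- Predictable factor of the correction term in the weighted deviation of the score. -/
noncomputable def devScale (P : Measure Ω) (init : Fin K → Ω → ℝ) (r : ℕ → Fin K → Ω → ℝ)
    (a : ℕ → Ω → Fin K) (γ : ℝ) (b : Fin K) (s : ℕ) (ω : Ω) : ℝ :=
  if γ / 2 ≤ condProp P init r a s b ω then 1 / √(condProp P init r a s b ω) else 0

/-- The weighted deviation of the score of arm `b` in round `s`, set to `0` when the propensity
is below `γ / 2`. -/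
noncomputable def dev (P : Measure Ω) (init : Fin K → Ω → ℝ) (r : ℕ → Fin K → Ω → ℝ)
    (a : ℕ → Ω → Fin K) (γ μ : ℝ) (b : Fin K) (s : ℕ) (ω : Ω) : ℝ :=
  devBase P init r a γ μ b s ω + devScale P init r a γ b s ω *
    (if a s ω = b then r s (a s ω) ω - (pathOf init r a ω).avg s b else 0)

theorem measurableSet_le_condProp (γ : ℝ) (s : ℕ) (b : Fin K) :
    MeasurableSet[history init r a s] {ω | γ / 2 ≤ condProp P init r a s b ω} :=
  measurable_condProp s b measurableSet_Ici

theorem measurable_devBase (γ μ : ℝ) (b : Fin K) (s : ℕ) :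
    Measurable[history init r a s] (devBase P init r a γ μ b s) :=
  Measurable.ite (measurableSet_le_condProp γ s b)
    ((measurable_condProp s b).sqrt.mul ((measurable_avg_history s b).sub_const μ))
    measurable_const

theorem measurable_devScale (γ : ℝ) (b : Fin K) (s : ℕ) :
    Measurable[history init r a s] (devScale P init r a γ b s) :=
  Measurable.ite (measurableSet_le_condProp γ s b)
    ((measurable_condProp s b).sqrt.const_div 1) measurable_const

theorem measurable_dev (γ μ : ℝ) (b : Fin K) (s : ℕ) :
    Measurable[history init r a (s + 1)] (dev P init r a γ μ b s) := by
  have hm : history init r a s ≤ history init r a (s + 1) := history_mono (Nat.le_succ s)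
  refine Measurable.add ((measurable_devBase γ μ b s).mono hm le_rfl)
    (Measurable.mul ((measurable_devScale γ b s).mono hm le_rfl) (Measurable.ite ?_ ?_ ?_))
  · exact measurable_arm_history (Nat.lt_succ_self s) (measurableSet_singleton b)
  · exact (measurable_reward_history (Nat.lt_succ_self s)).sub
      ((measurable_avg_history s b).mono hm le_rfl)
  · exact measurable_const

/-- Links the martingale to the algorithm. `dev` uses the conditional probability, which is
history-measurable by construction, so measurability of the Thompson propensities is never needed;
the cut at `γ / 2` keeps the inverse weights bounded after elimination. -/
theorem dev_eq {γ μ κ : ℝ} (hγ : 0 < γ) {b : Fin K} {s T : ℕ} {ω : Ω}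
    (hq : condProp P init r a s b ω = (pathOf init r a ω).prop T γ κ s b)
    (hle : γ / 2 ≤ (pathOf init r a ω).prop T γ κ s b) :
    dev P init r a γ μ b s ω = √((pathOf init r a ω).prop T γ κ s b) *
      ((pathOf init r a ω).score ((pathOf init r a ω).prop T γ κ) s b - μ) := by
  have h0 : 0 < √((pathOf init r a ω).prop T γ κ s b) := Real.sqrt_pos.2 (by linarith)
  rw [dev, devBase, devScale, hq, if_pos hle, if_pos hle, Path.score]
  have e : (pathOf init r a ω).arm s = a s ω := rfl
  have e' : (pathOf init r a ω).reward s = r s (a s ω) ω := rfl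
  rw [e, e']
  have hs := Real.sq_sqrt (show 0 ≤ (pathOf init r a ω).prop T γ κ s b by linarith)
  set d := √((pathOf init r a ω).prop T γ κ s b)
  rw [← hs]
  split_ifs
  · field_simp; ring
  · ring

namespace IsRun

variable {ν : Fin K → Measure ℝ} {T : ℕ} {γ κ M : ℝ}

theorem measurable_observed (H : IsRun P ν T γ κ init r a) (s : ℕ) :
    Measurable fun ω => r s (a s ω) ω := by
  have e : (fun ω => r s (a s ω) ω) = fun ω => ∑ b, if a s ω = b then r s b ω else 0 := by
    funext ω; simp
  rw [e]
  exact Finset.measurable_fun_sum _ fun b _ => Measurable.ite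
    (H.measurable_arm s (measurableSet_singleton b)) (H.measurable_reward s b) measurable_const

theorem history_le (H : IsRun P ν T γ κ init r a) (t : ℕ) : history init r a t ≤ mΩ :=
  sup_le (iSup_le fun b => (H.measurable_init b).comap_le) (iSup₂_le fun s _ =>
    sup_le (H.measurable_arm s).comap_le (H.measurable_observed s).comap_le)

theorem ae_abs_init_le (H : IsRun P ν T γ κ init r a) (hν : ∀ b, ∀ᵐ x ∂ν b, |x| ≤ M) :
    ∀ᵐ ω ∂P, ∀ b, |init b ω| ≤ M := by
  rw [ae_all_iff]
  intro b
  have h := hν b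
  rw [← H.law_init b] at h
  exact ae_of_ae_map (H.measurable_init b).aemeasurable h

theorem ae_abs_reward_le (H : IsRun P ν T γ κ init r a) (hν : ∀ b, ∀ᵐ x ∂ν b, |x| ≤ M) :
    ∀ᵐ ω ∂P, ∀ s < T, ∀ b, |r s b ω| ≤ M := by
  rw [ae_all_iff]
  intro s
  rw [Filter.eventually_imp_distrib_left]
  intro hs
  rw [ae_all_iff]
  intro b
  have h := hν b
  rw [← H.law_reward s hs b] at h
  exact ae_of_ae_map (H.measurable_reward s b).aemeasurable h

theorem ae_condProp_eq (H : IsRun P ν T γ κ init r a) :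
    ∀ᵐ ω ∂P, ∀ s < T, ∀ b,
      condProp P init r a s b ω = (pathOf init r a ω).prop T γ κ s b := by
  rw [ae_all_iff]
  intro s
  rw [Filter.eventually_imp_distrib_left]
  intro hs
  rw [ae_all_iff]
  exact H.arm_law s hs

theorem ae_abs_avg_le (H : IsRun P ν T γ κ init r a) (hν : ∀ b, ∀ᵐ x ∂ν b, |x| ≤ M) {s : ℕ}
    (hs : s < T) (b : Fin K) : ∀ᵐ ω ∂P, |(pathOf init r a ω).avg s b| ≤ M := by
  filter_upwards [H.ae_abs_init_le hν, H.ae_abs_reward_le hν] with ω h1 h2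
  exact Path.abs_avg_le _ (h1 b) fun u hu => h2 u (by omega) _

/-- Almost surely, only arms of positive propensity are pulled. -/
theorem ae_condProp_ne_zero [IsProbabilityMeasure P] (H : IsRun P ν T γ κ init r a) :
    ∀ᵐ ω ∂P, ∀ s, condProp P init r a s (a s ω) ω ≠ 0 := by
  rw [ae_all_iff]
  intro s
  have key : ∀ b, ∀ᵐ ω ∂P, a s ω = b → condProp P init r a s b ω ≠ 0 := by
    intro b
    have hA : MeasurableSet (a s ⁻¹' {b}) := H.measurable_arm s (measurableSet_singleton b)
    have hZ : MeasurableSet[history init r a s] (condProp P init r a s b ⁻¹' {0}) :=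
      measurable_condProp s b (measurableSet_singleton 0)
    -- The probability of pulling `b` while its propensity vanishes is the integral of that
    -- propensity over its own zero set.
    have h1 := setIntegral_condExp (μ := P) (H.history_le s)
      (f := (a s ⁻¹' {b}).indicator fun _ => (1 : ℝ)) ((integrable_const 1).indicator hA) hZ
    have h2 : ∫ ω in condProp P init r a s b ⁻¹' {0}, condProp P init r a s b ω ∂P = 0 := by
      rw [setIntegral_congr_fun (H.history_le s _ hZ) (g := fun _ => (0 : ℝ)) fun ω hω => hω]
      simp
    rw [condProp] at h2
    rw [condProp, h2, setIntegral_indicator hA, setIntegral_const, smul_eq_mul, mul_one] at h1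
    have h3 := (measureReal_eq_zero_iff (by simp)).1 h1.symm
    rw [ae_iff]
    convert h3 using 2
    ext ω
    simp only [condProp, Set.mem_ofPred_eq, Set.mem_inter_iff, Set.mem_preimage,
      Set.mem_singleton_iff]
    tauto
  filter_upwards [ae_all_iff.2 key] with ω h
  exact h _ rfl

/-- With `q` the propensity and `A` the running average, the correction has conditional mean `(μ -
A) * q / √q`, which cancels the predictable part `√q * (A - μ)`. -/
theorem condExp_dev_eq_zero [IsProbabilityMeasure P] (H : IsRun P ν T γ κ init r a) (hγ : 0 < γ)
    (hγ1 : γ < 1) (hν : ∀ b, ∀ᵐ x ∂ν b, |x| ≤ M) (hM : 0 < M) (b : Fin K) {s : ℕ} (hs : s < T) :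
    P[dev P init r a γ (∫ x, x ∂ν b) b s | history init r a s] =ᵐ[P] 0 := by
  have hFm : history init r a s ≤ mΩ := H.history_le s
  have hJm : MeasurableSet (a s ⁻¹' {b}) := H.measurable_arm s (measurableSet_singleton b)
  set J : Ω → ℝ := (a s ⁻¹' {b}).indicator fun _ => 1 with hJ
  set A : Ω → ℝ := fun ω => (pathOf init r a ω).avg s b with hA
  have hAm : Measurable[history init r a s] A := measurable_avg_history s b
  have hAb : ∀ᵐ ω ∂P, ‖A ω‖ ≤ M := H.ae_abs_avg_le hν hs b
  have hJi : Integrable J P := (integrable_const 1).indicator hJm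
  have hri : Integrable (r s b) P := by
    refine Integrable.of_bound (H.measurable_reward s b).aestronglyMeasurable M ?_
    filter_upwards [H.ae_abs_reward_le hν] with ω h using h s hs b
  have hmean : ∫ ω, r s b ω ∂P = ∫ x, x ∂ν b := by
    rw [← H.law_reward s hs b,
      integral_map (f := fun x => x) (H.measurable_reward s b).aemeasurable
        aestronglyMeasurable_id]
  have hJr : P[J * r s b | history init r a s] =ᵐ[P]
      fun ω => (∫ x, x ∂ν b) * condProp P init r a s b ω := by
    have hcm : Measurable (fun ω b => r s b ω) :=
      measurable_pi_lambda _ fun b => H.measurable_reward s b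
    have h := condExp_indicator_mul_of_indep (P := P) (f := r s b) (E := a s ⁻¹' {b})
      le_sup_left (sup_le hFm (H.measurable_arm s).comap_le) hcm.comap_le
      (le_sup_right (a := history init r a s) _ ⟨{b}, trivial, rfl⟩)
      (Measurable.stronglyMeasurable
        (measurable_iff_comap_le.2 (by
          rw [show r s b = (fun f : Fin K → ℝ => f b) ∘ fun ω b => r s b ω from rfl,
            ← MeasurableSpace.comap_comp]
          exact MeasurableSpace.comap_mono (measurable_pi_apply b).comap_le)))
      hri (H.indep s hs)
    rwa [hmean] at h
  have hAJ : P[A * J | history init r a s] =ᵐ[P] fun ω => A ω * condProp P init r a s b ω :=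
    condExp_stronglyMeasurable_mul_of_bound hFm hAm.stronglyMeasurable hJi M hAb
  have hJri : Integrable (J * r s b) P := by
    have e : J * r s b = (a s ⁻¹' {b}).indicator (r s b) := by
      funext ω
      by_cases h : ω ∈ a s ⁻¹' {b} <;> simp [hJ, h]
    rw [e]
    exact hri.indicator hJm
  have hAJi : Integrable (A * J) P :=
    hJi.bdd_mul (hAm.mono hFm le_rfl).aestronglyMeasurable hAb
  set w := devScale P init r a γ b s with hw
  set u := devBase P init r a γ (∫ x, x ∂ν b) b s with hu
  have hwb : ∀ᵐ ω ∂P, ‖w ω‖ ≤ 1 / √(γ / 2) := ae_of_all _ fun ω => by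
    have h0 : 0 < √(γ / 2) := Real.sqrt_pos.2 (half_pos hγ)
    rw [hw, devScale]
    split_ifs with h
    · have h1 := Real.sqrt_le_sqrt h
      rw [Real.norm_of_nonneg (by positivity)]
      gcongr
    · rw [norm_zero]; positivity
  have hZi : Integrable (J * r s b - A * J) P := hJri.sub hAJi
  have hwZi : Integrable (w * (J * r s b - A * J)) P :=
    hZi.bdd_mul ((measurable_devScale γ b s).mono hFm le_rfl).aestronglyMeasurable hwb
  have hdev : dev P init r a γ (∫ x, x ∂ν b) b s = u + w * (J * r s b - A * J) := by
    funext ω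
    have hJ' : J ω = if a s ω = b then 1 else 0 := by
      by_cases h : a s ω = b <;> simp [hJ, h]
    simp only [dev, Pi.add_apply, Pi.mul_apply, Pi.sub_apply, hJ', ← hu, ← hw]
    split_ifs with h
    · rw [h]; ring
    · ring
  have hui : Integrable u P := by
    refine Integrable.of_bound
      ((measurable_devBase γ _ b s).mono hFm le_rfl).aestronglyMeasurable
      (1 * (M + |∫ x, x ∂ν b|)) ?_
    filter_upwards [hAb, H.ae_condProp_eq] with ω h1 h2
    rw [hu, devBase]
    split_ifs
    · rw [norm_mul, Real.norm_of_nonneg (Real.sqrt_nonneg _)]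
      refine mul_le_mul ?_ ((norm_sub_le _ _).trans (add_le_add h1 le_rfl)) (norm_nonneg _)
        zero_le_one
      rw [Real.sqrt_le_one, h2 s hs b]
      exact Path.prop_le_one _ T hγ.le hγ1.le s b
    · simp; positivity
  rw [hdev]
  refine (condExp_add hui hwZi _).trans ?_
  rw [condExp_of_stronglyMeasurable hFm (measurable_devBase γ _ b s).stronglyMeasurable hui]
  filter_upwards [condExp_stronglyMeasurable_mul_of_bound hFm
    (measurable_devScale γ b s).stronglyMeasurable hZi _ hwb, condExp_sub hJri hAJi _, hJr, hAJ]
    with ω h1 h2 h3 h4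
  rw [Pi.add_apply, h1, Pi.mul_apply, h2, Pi.sub_apply, h3, h4, devBase, devScale]
  split_ifs with h
  · have hd : 0 < √(condProp P init r a s b ω) := Real.sqrt_pos.2 (by linarith)
    have hsq := Real.sq_sqrt (show 0 ≤ condProp P init r a s b ω by linarith)
    simp only [hA, Pi.zero_apply]
    field_simp
    rw [hsq]
    ring
  · simp

/-- The correction, pulled or not, lies in `[-M - A, M - A]` scaled by `1 / √q`, since `|A| ≤ M`.
The shifted interval contains `0` because `(1 - q) * A + q * μ` is a convex combination of numbers
in `[-M, M]`. -/
theorem dev_mem [IsProbabilityMeasure P] (H : IsRun P ν T γ κ init r a) (hγ0 : 0 < γ)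
    (hγ1 : γ < 1) (hν : ∀ b, ∀ᵐ x ∂ν b, |x| ≤ M) (hM : 0 < M) {μ : ℝ} (hμ : |μ| ≤ M) (b : Fin K)
    {s : ℕ} (hs : s < T) : ∀ᵐ ω ∂P,
      devBase P init r a γ μ b s ω -
        devScale P init r a γ b s ω * (M + (pathOf init r a ω).avg s b) ≤ 0 ∧
      0 ≤ devBase P init r a γ μ b s ω +
        devScale P init r a γ b s ω * (M - (pathOf init r a ω).avg s b) ∧
      (devBase P init r a γ μ b s ω +
        devScale P init r a γ b s ω * (M - (pathOf init r a ω).avg s b)) -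
      (devBase P init r a γ μ b s ω -
        devScale P init r a γ b s ω * (M + (pathOf init r a ω).avg s b)) ≤ 2 * M / √(γ / 2) ∧
      devBase P init r a γ μ b s ω -
        devScale P init r a γ b s ω * (M + (pathOf init r a ω).avg s b) ≤
        dev P init r a γ μ b s ω ∧
      dev P init r a γ μ b s ω ≤ devBase P init r a γ μ b s ω +
        devScale P init r a γ b s ω * (M - (pathOf init r a ω).avg s b) := by
  filter_upwards [H.ae_abs_avg_le hν hs b, H.ae_abs_reward_le hν, H.ae_condProp_eq]
    with ω h1 h2 h3
  have hq1 : condProp P init r a s b ω ≤ 1 := by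
    rw [h3 s hs b]; exact Path.prop_le_one _ T hγ0.le hγ1.le s b
  have hr := abs_le.1 (h2 s hs (a s ω))
  have hA := abs_le.1 h1
  have hμ' := abs_le.1 hμ
  unfold dev devBase devScale
  set A := (pathOf init r a ω).avg s b
  set q := condProp P init r a s b ω
  split_ifs with hq hab hab
  all_goals try (simp; positivity)
  all_goals
    have hd : 0 < √q := Real.sqrt_pos.2 (by linarith)
    have hsq := Real.sq_sqrt (show 0 ≤ q by linarith)
    have hsc : 2 * M / √q ≤ 2 * M / √(γ / 2) := by gcongr
    have hinv : 0 < 1 / √q := by positivity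
    have e1 : √q * (A - μ) - 1 / √q * (M + A) = 1 / √q * (q * (A - μ) - (M + A)) := by
      rw [← hsq]; field_simp; simp
    have e2 : √q * (A - μ) + 1 / √q * (M - A) = 1 / √q * (q * (A - μ) + (M - A)) := by
      rw [← hsq]; field_simp; simp
    refine ⟨?_, ?_, ?_, ?_, ?_⟩
    · rw [e1]
      exact mul_nonpos_of_nonneg_of_nonpos hinv.le (by nlinarith)
    · rw [e2]
      exact mul_nonneg hinv.le (by nlinarith)
    · refine le_trans (le_of_eq ?_) hsc
      ring
    · nlinarith
    · nlinarith

/-- Concentration of the weighted deviation sums. -/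
theorem measureReal_abs_sum_dev_ge_le [IsProbabilityMeasure P] (H : IsRun P ν T γ κ init r a)
    (hγ0 : 0 < γ) (hγ1 : γ < 1) (hν : ∀ b, ∀ᵐ x ∂ν b, |x| ≤ M) (hM : 0 < M) {b : Fin K}
    (hμ : |∫ x, x ∂ν b| ≤ M) {t : ℕ} (ht0 : 0 < t) (ht : t ≤ T) {L : ℝ} (hL : 0 ≤ L) :
    P.real {ω | M * √(12 * t * L / γ) ≤
      |∑ s ∈ Finset.range t, dev P init r a γ (∫ x, x ∂ν b) b s ω|} ≤
      2 * Real.exp (-(3 * L)) := by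
  have ht' : (0 : ℝ) < t := by exact_mod_cast ht0
  have hR : 0 < 2 * M / √(γ / 2) := by
    have := Real.sqrt_pos.2 (half_pos hγ0); positivity
  have hmem : ∀ s < t, _ := fun s hs => H.dev_mem hγ0 hγ1 hν hM hμ b (lt_of_lt_of_le hs ht)
  have h := measureReal_abs_sum_ge_le (P := P) H.history_le history_mono
    (X := dev P init r a γ (∫ x, x ∂ν b) b)
    (lo := fun s ω => devBase P init r a γ (∫ x, x ∂ν b) b s ω -
        devScale P init r a γ b s ω * (M + (pathOf init r a ω).avg s b))
    (hi := fun s ω => devBase P init r a γ (∫ x, x ∂ν b) b s ω +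
        devScale P init r a γ b s ω * (M - (pathOf init r a ω).avg s b))
    (n := t) (B := 2 * M / √(γ / 2)) (R := 2 * M / √(γ / 2)) (x := M * √(12 * t * L / γ)) hR
    (by positivity) (measurable_dev γ _ b)
    (fun s => (measurable_devBase γ _ b s).sub ((measurable_devScale γ b s).mul
      ((measurable_avg_history s b).const_add M)))
    (fun s => (measurable_devBase γ _ b s).add ((measurable_devScale γ b s).mul
      ((measurable_avg_history s b).const_sub M)))
    hmem
    (fun s hs => by
      filter_upwards [hmem s hs] with ω ⟨h1, h2, h3, h4, h5⟩
      exact abs_le.2 ⟨by linarith, by linarith⟩)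
    (fun s hs => H.condExp_dev_eq_zero hγ0 hγ1 hν hM b (lt_of_lt_of_le hs ht)) ht0
  -- With `R ^ 2 = 8 * M ^ 2 / γ` and `x ^ 2 = 12 * M ^ 2 * t * L / γ`, the exponent is exactly `-3
  -- * L`.
  refine h.trans (le_of_eq ?_)
  congr 2
  rw [mul_pow, div_pow, Real.sq_sqrt (by positivity), Real.sq_sqrt (by positivity)]
  field_simp
  ring

end IsRun

end

/-! ### From concentration to regret. -/

section

theorem abs_mean_le {ν : Measure ℝ} [IsProbabilityMeasure ν] {M : ℝ} (h : ∀ᵐ x ∂ν, |x| ≤ M) :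
    |∫ x, x ∂ν| ≤ M := by
  have := norm_integral_le_of_norm_le_const (μ := ν) (f := fun x => x) (C := M) h
  simpa using this

variable {Ω : Type*}

/-- The regret is at most the range of the mean rewards times the number of rounds. -/
theorem regret_le {ν : Fin 2 → Measure ℝ} {M : ℝ} (hμ : ∀ b, |∫ x, x ∂ν b| ≤ M)
    (a : ℕ → Ω → Fin 2) (T : ℕ) (ω : Ω) : regret ν a T ω ≤ 2 * M * T := by
  unfold regret
  have hsup : (⨆ b, ∫ x, x ∂ν b) ≤ M := ciSup_le fun b => (abs_le.1 (hμ b)).2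
  have := Finset.sum_le_card_nsmul (Finset.range T)
    (fun t => (⨆ b, ∫ x, x ∂ν b) - ∫ x, x ∂ν (a t ω)) (2 * M)
    (fun t _ => by have := (abs_le.1 (hμ (a t ω))).1; linarith)
  simpa [mul_comm] using this

variable [mΩ : MeasurableSpace Ω] {P : Measure Ω}

/-- Regret bound on a path with accurate estimates. -/
theorem regret_le_of_dev_le {init : Fin 2 → Ω → ℝ} {r : ℕ → Fin 2 → Ω → ℝ}
    {a : ℕ → Ω → Fin 2} {ν : Fin 2 → Measure ℝ} {T : ℕ} {γ κ M : ℝ} {ω : Ω}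
    (hγ0 : 0 < γ) (hγ1 : γ < 1) (hM : 0 < M) (hκ : kappa M γ ≤ κ) (hT : Real.exp 16 ≤ T)
    (hμ : ∀ b, |∫ x, x ∂ν b| ≤ M) (hi : ∀ b, |init b ω| ≤ M)
    (hr : ∀ s < T, ∀ b, |r s b ω| ≤ M)
    (hq : ∀ s < T, ∀ b, condProp P init r a s b ω = (pathOf init r a ω).prop T γ κ s b)
    (hne : ∀ s, condProp P init r a s (a s ω) ω ≠ 0)
    (hS : ∀ t < T, 0 < t → ∀ b,
      |∑ s ∈ Finset.range t, dev P init r a γ (∫ x, x ∂ν b) b s ω| ≤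
        M * √(12 * t * Real.log T / γ)) :
    regret ν a T ω ≤ (2 * M + 6 * κ * √(4 * (4 * (M + 4 * M / γ) ^ 2 + 1) / γ)) *
      √(T * Real.log T) := by
  have hκ0 : 0 < κ := (kappa_pos hγ0 hM).trans_le hκ
  have hT0 : (0 : ℝ) < T := (Real.exp_pos _).trans_le hT
  have hL16 : 16 ≤ Real.log T := by rwa [Real.le_log_iff_exp_le hT0]
  have hT1 : (1 : ℝ) ≤ T := by have := Real.add_one_le_exp (16 : ℝ); linarith
  have hL : 0 ≤ Real.log T := by linarith
  set c := 3 * κ * √(4 * (4 * (M + 4 * M / γ) ^ 2 + 1) / γ) with hc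
  have hc0 : 0 ≤ c := by positivity
  obtain ⟨i, hbest⟩ := Finite.exists_max fun b => ∫ x, x ∂ν b
  have hsup : (⨆ b, ∫ x, x ∂ν b) = ∫ x, x ∂ν i :=
    le_antisymm (ciSup_le hbest) (le_ciSup (f := fun b => ∫ x, x ∂ν b)
      (Set.finite_range _).bddAbove i)
  have hgap : ∀ t, t + 1 < T → (⨆ b, ∫ x, x ∂ν b) - ∫ x, x ∂ν (a (t + 1) ω) ≤
      c * √(Real.log T) * (1 / √((t + 1 : ℕ) : ℝ)) := by
    intro t ht
    rw [hsup]
    by_cases hai : a (t + 1) ω = i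
    · rw [hai, sub_self]; positivity
    have hmain := (pathOf init r a ω).best_mem_active (T := T) (κ := κ)
      (μ := fun b => ∫ x, x ∂ν b) hγ0 hγ1 hM hκ hT hi (fun s hs => hr s hs _)
      (fun t ht hall b => by
        rcases Nat.eq_zero_or_pos t with rfl | h0
        · simp
        refine le_trans (le_of_eq ?_) (hS t ht h0 b)
        refine congrArg _ (Finset.sum_congr rfl fun s hs => ?_)
        have hs := Finset.mem_range.1 hs
        refine (dev_eq hγ0 (hq s (by omega) b) ?_).symm
        have := Path.le_prop (pathOf init r a ω) T (κ := κ) hγ0.le hγ1.le (t := s) (b := b)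
          (by rw [hall s hs]; simp)
        simpa using this)
      (Ne.symm hai) (hbest (a (t + 1) ω)) (t + 1) ht
    -- A pulled arm has nonzero propensity, hence is still eligible, so the gap bound applies to it.
    refine hmain.2 (Nat.succ_pos t) ?_
    by_contra hna
    exact hne (t + 1) (by rw [hq (t + 1) ht]; exact Path.prop_eq_zero _ T hna)
  obtain ⟨n, rfl⟩ : ∃ n, T = n + 1 := ⟨T - 1, by
    have : 1 ≤ T := by exact_mod_cast hT1
    omega⟩
  unfold regret
  -- Round `0` precedes any estimate and is charged the full range `2 * M`.
  rw [Finset.sum_range_succ']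
  have h1 := Finset.sum_le_sum fun t (ht : t ∈ Finset.range n) =>
    hgap t (by have := Finset.mem_range.1 ht; omega)
  rw [← Finset.mul_sum] at h1
  have h2 := mul_le_mul_of_nonneg_left (sum_one_div_sqrt_le n)
    (mul_nonneg hc0 (Real.sqrt_nonneg (Real.log ((n + 1 : ℕ) : ℝ))))
  have h3 : √(n : ℝ) ≤ √((n + 1 : ℕ) : ℝ) := Real.sqrt_le_sqrt (by simp)
  have h4 : (⨆ b, ∫ x, x ∂ν b) - ∫ x, x ∂ν (a 0 ω) ≤ 2 * M := by
    rw [hsup]; linarith [(abs_le.1 (hμ i)).2, (abs_le.1 (hμ (a 0 ω))).1]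
  have h5 : 1 ≤ √(((n + 1 : ℕ) : ℝ) * Real.log ((n + 1 : ℕ) : ℝ)) :=
    Real.le_sqrt_of_sq_le (by nlinarith)
  have h6 := mul_le_mul_of_nonneg_left h5 (mul_nonneg zero_le_two hM.le)
  have h7 := mul_le_mul_of_nonneg_left h3
    (mul_nonneg hc0 (Real.sqrt_nonneg (Real.log ((n + 1 : ℕ) : ℝ))))
  have h8 := Real.sqrt_mul hT0.le (Real.log ((n + 1 : ℕ) : ℝ))
  have h9 : 6 * κ * √(4 * (4 * (M + 4 * M / γ) ^ 2 + 1) / γ) = 2 * c := by rw [hc]; ring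
  rw [h9, add_mul]
  rw [h8] at h6 ⊢
  linarith

/-- Regret bound with high probability for long horizons. -/
theorem IsRun.le_measureReal_regret_le [IsProbabilityMeasure P] {init : Fin 2 → Ω → ℝ}
    {r : ℕ → Fin 2 → Ω → ℝ} {a : ℕ → Ω → Fin 2} {ν : Fin 2 → Measure ℝ} {T : ℕ} {γ κ M : ℝ}
    (H : IsRun P ν T γ κ init r a)
    (hγ0 : 0 < γ) (hγ1 : γ < 1) (hM : 0 < M) (hκ : kappa M γ ≤ κ) (hT : Real.exp 16 ≤ T)
    (hν : ∀ b, ∀ᵐ x ∂ν b, |x| ≤ M) (hμ : ∀ b, |∫ x, x ∂ν b| ≤ M) :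
    1 - 4 / (T : ℝ) ^ 2 ≤ P.real {ω | regret ν a T ω ≤
      (2 * M + 6 * κ * √(4 * (4 * (M + 4 * M / γ) ^ 2 + 1) / γ)) * √(T * Real.log T)} := by
  have hT0 : (0 : ℝ) < T := (Real.exp_pos _).trans_le hT
  have hL : 0 ≤ Real.log T := by
    have : 16 ≤ Real.log T := by rwa [Real.le_log_iff_exp_le hT0]
    linarith
  set good := {ω | regret ν a T ω ≤
    (2 * M + 6 * κ * √(4 * (4 * (M + 4 * M / γ) ^ 2 + 1) / γ)) * √(T * Real.log T)}
  set bad : ℕ × Fin 2 → Set Ω := fun z => {ω | M * √(12 * z.1 * Real.log T / γ) ≤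
      |∑ s ∈ Finset.range z.1, dev P init r a γ (∫ x, x ∂ν z.2) z.2 s ω|}
  set I : Finset (ℕ × Fin 2) := (Finset.Ico 1 T) ×ˢ Finset.univ with hI
  have hbound : ∀ z ∈ I, P.real (bad z) ≤ 2 / (T : ℝ) ^ 3 := by
    intro z hz
    rw [hI, Finset.mem_product, Finset.mem_Ico] at hz
    refine (H.measureReal_abs_sum_dev_ge_le hγ0 hγ1 hν hM (hμ z.2) hz.1.1 hz.1.2.le hL).trans
      (le_of_eq ?_)
    rw [Real.exp_neg, show (3 : ℝ) * Real.log T = (3 : ℕ) * Real.log T by norm_num,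
      ← Real.log_pow, Real.exp_log (by positivity), div_eq_mul_inv]
  have hunion : P.real (⋃ z ∈ I, bad z) ≤ 4 / (T : ℝ) ^ 2 := by
    refine (measureReal_biUnion_finset_le I bad).trans
      ((Finset.sum_le_card_nsmul I _ _ hbound).trans ?_)
    have hcard : (I.card : ℝ) ≤ T * 2 := by
      have : I.card ≤ T * 2 := by simp [hI]
      exact_mod_cast this
    rw [nsmul_eq_mul]
    calc (I.card : ℝ) * (2 / (T : ℝ) ^ 3) ≤ T * 2 * (2 / (T : ℝ) ^ 3) := by gcongr
      _ = 4 / (T : ℝ) ^ 2 := by field_simp; norm_num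
  have hcover : ∀ᵐ ω ∂P, ω ∈ good ∪ ⋃ z ∈ I, bad z := by
    filter_upwards [H.ae_abs_init_le hν, H.ae_abs_reward_le hν, H.ae_condProp_eq,
      H.ae_condProp_ne_zero] with ω h1 h2 h3 h4
    rw [Set.mem_union, or_iff_not_imp_right]
    intro h
    refine regret_le_of_dev_le (P := P) hγ0 hγ1 hM hκ hT hμ h1 h2 h3 h4 fun t ht h0 b => ?_
    by_contra! hlt
    refine h (Set.mem_biUnion (x := (t, b)) ?_ hlt.le)
    simp [hI, ht]
    omega
  have h1 : P.real (good ∪ ⋃ z ∈ I, bad z) = 1 := by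
    have h : (good ∪ ⋃ z ∈ I, bad z : Set Ω) =ᵐ[P] Set.univ := Filter.eventuallyEq_univ.2 hcover
    rw [measureReal_congr h, probReal_univ]
  have h2 := measureReal_union_le (μ := P) good (⋃ z ∈ I, bad z)
  linarith

end

end DATS

theorem corollary1 (γ M κ : ℝ) (hγ0 : 0 < γ) (hγ1 : γ < 1) (hM : 0 < M)
    (hκ : DATS.kappa M γ ≤ κ) :
    ∃ C : ℝ, ∀ (T : ℕ), 1 ≤ T →
      ∀ (ν : Fin 2 → Measure ℝ), (∀ b, IsProbabilityMeasure (ν b)) →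
        (∀ b, ∀ᵐ x ∂ν b, |x| ≤ M) →
      ∀ (Ω : Type*) (_ : MeasurableSpace Ω) (P : Measure Ω), IsProbabilityMeasure P →
      ∀ (init : Fin 2 → Ω → ℝ) (r : ℕ → Fin 2 → Ω → ℝ) (a : ℕ → Ω → Fin 2),
        DATS.IsRun P ν T γ κ init r a →
        1 - 2 / (T : ℝ) ^ 2 - 2 * Real.log T / (T : ℝ) ^ 2 ≤
          P.real {ω | DATS.regret ν a T ω ≤ C * √(T * Real.log T)} := by
  have hκ0 : 0 < κ := (DATS.kappa_pos hγ0 hM).trans_le hκ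
  set C₁ := 2 * M + 6 * κ * √(4 * (4 * (M + 4 * M / γ) ^ 2 + 1) / γ) with hC₁
  -- The second entry covers `2 ≤ T < exp 16`, where the trivial regret bound `2 * M * T` suffices.
  refine ⟨max C₁ (2 * M * Real.exp 16), ?_⟩
  intro T hT ν hprob hν Ω _ P hP init r a H
  have hμ : ∀ b, |∫ x, x ∂ν b| ≤ M := fun b => DATS.abs_mean_le (hν b)
  have hT1 : (1 : ℝ) ≤ T := by exact_mod_cast hT
  have hlog : 0 ≤ Real.log T := Real.log_nonneg hT1
  rcases le_or_gt (Real.exp 16) (T : ℝ) with hbig | hsmall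
  · have hL16 : 16 ≤ Real.log T := by rwa [Real.le_log_iff_exp_le (by linarith)]
    have h1 := H.le_measureReal_regret_le hγ0 hγ1 hM hκ hbig hν hμ
    -- The union bound loses only `4 / T ^ 2`; `log T ≥ 1` is enough here.
    have h2 : 4 / (T : ℝ) ^ 2 ≤ 2 / (T : ℝ) ^ 2 + 2 * Real.log T / (T : ℝ) ^ 2 := by
      rw [← add_div]; gcongr; linarith
    refine le_trans (by linarith) (h1.trans (measureReal_mono fun ω hω => ?_))
    exact le_trans hω (mul_le_mul_of_nonneg_right (le_max_left _ _) (Real.sqrt_nonneg _))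
  -- At `T = 1` the regret threshold is `0`, but the claimed probability bound is `-1`.
  · rcases hT.eq_or_lt with rfl | hT2
    · refine le_trans ?_ measureReal_nonneg
      norm_num
    have hT2' : (2 : ℝ) ≤ T := by exact_mod_cast hT2
    have hsq : 1 ≤ √(T * Real.log T) := by
      have h1 := Real.log_le_log zero_lt_two hT2'
      have h2 := Real.log_two_gt_d9
      exact Real.le_sqrt_of_sq_le (by nlinarith)
    have hall : {ω | DATS.regret ν a T ω ≤ max C₁ (2 * M * Real.exp 16) * √(T * Real.log T)}
        = Set.univ := by
      refine Set.eq_univ_of_forall fun ω => (DATS.regret_le hμ a T ω).trans ?_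
      calc 2 * M * T ≤ 2 * M * Real.exp 16 := by gcongr
        _ ≤ max C₁ (2 * M * Real.exp 16) := le_max_right _ _
        _ ≤ _ := le_mul_of_one_le_right (le_max_of_le_right (by positivity)) hsq
    rw [hall, probReal_univ]
    have h1 : 0 ≤ 2 / (T : ℝ) ^ 2 := by positivity
    have h2 : 0 ≤ 2 * Real.log T / (T : ℝ) ^ 2 := by positivity
    linarith
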